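/- **Setting.** Let $\tilde h:\mathbb R\to\mathbb R$ be a Meyer low-pass filter: even, $2\pi$-periodic, of class $C^2$ (for instance smooth), with $\tilde h=\sqrt2$ on $[-\pi/3,\pi/3]$ and $\tilde h(\omega)^2+\tilde h(\omega+\pi)^2=2$. The Meyer scaling function $\phi^*$ and mother wavelet $\psi^*$ are the functions with Fourier transforms (kernel $e^{-i\omega x}$) $\tilde\phi(\omega)=2^{-1/2}\tilde h(\omega/2)\mathbf 1_{|\omega|\le 4\pi/3}$ and $\tilde\psi(\omega)=2^{-1/2}e^{-i\omega/2}\tilde h(\omega/2+\pi)\tilde\phi(\omega/2)$. For $j\ge 0$, $0\le k<2^j$ put $\phi_{j,k}(x)=2^{j/2}\sum_{i\in\mathbb Z}\phi^*(2^j(x+i)-k)$ and $\psi_{j,k}(x)=2^{j/2}\sum_{i\in\mathbb Z}\psi^*(2^j(x+i)-k)$. For a real function $g$ on $[0,1]$ write $g_\ell=\int_0^1 g(u)e^{-2\pi i\ell u}\,du$; let $\psi^{j,k}_\ell$ be the Fourier coefficients of $\psi_{j,k}$, let $C_j=\{\ell:\psi_\ell^{j,k}\ne0\}$, and let $\|\cdot\|$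 be the norm of $L^2([0,1])$. Let $f\in L^2([0,1])$, $f\ge0$, $\int_0^1 f=1$, $\|f\|_\infty=\sup_{[0,1]}|f|<\infty$, and let $X_1,\dots,X_n$ be i.i.d. with density $f$ on $[0,1]$. Put $c_{j,k}=\int_0^1 f\phi_{j,k}$, $\beta_{j,k}=\int_0^1 f\psi_{j,k}$, $$\hat\beta_{j,k}=\sum_{\ell\in C_j}\overline{\psi^{j,k}_\ell}\,\frac1n\sum_{m=1}^n e^{-2\pi i\ell X_m},\qquad \hat V_{j,k}=\frac1{n^2}\sum_{m=1}^n\Big|\sum_{\ell\in C_j}\overline{\psi^{j,k}_\ell}e^{-2\pi i\ell X_m}\Big|^2,\qquad \eta_j=\sum_{\ell\in C_j}|\psi^{j,k}_\ell|,$$ define $\hat c_{j,k}$ like $\hat\beta_{j,k}$ with $\phi_{j,k}$ in place of $\psi_{j,k}$, and put $\sigma^2_{j_0,k}=\mathbb E(\hat c_{j_0,k}-c_{j_0,k})^2$ in the scaling term below and $\sigma^2_{j,k}=\mathbb E(\hat\beta_{j,k}-\beta_{j,k})^2$ in the wavelet terms. With $\kappa=\frac43+\sqrt{5/3}$, the random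 thresholds are $$\tau_{j,k}=\sqrt{2\delta\log(n)\Big(\hat V_{j,k}+\sqrt{2\delta\log(n)\hat V_{j,k}\tfrac{\eta_j^2}{n^2}}+\delta\log(n)\,\kappa\,\tfrac{\eta_j^2}{n^2}\Big)}+\frac{\delta\log(n)}{3n}\eta_j ,$$ and the estimator is $$\hat f_n=\sum_{k=0}^{2^{j_0}-1}\hat c_{j_0,k}\phi_{j_0,k}+\sum_{j=j_0}^{j_1}\sum_{k=0}^{2^j-1}\hat\beta_{j,k}\mathbf 1_{\{|\hat\beta_{j,k}|\ge\tau_{j,k}\}}\psi_{j,k}.$$ **Theorem.** Fix the filter $\tilde h$, $\alpha\ge0$ and $0<\eta\le1/2$. There are functions $C_1,C_2$ on $(\eta,\infty)$ with positive values, not depending on $n$ and $f$, with $\lim_{\delta\downarrow\eta}C_1(\delta)=\lim_{\delta\downarrow\eta}C_2(\delta)=+\infty$, such that for every $\delta>\eta$, every bounded density $f$ as above and every integer $n\ge e$ the following holds. Let $j_0,j_1$ be the integers with $2^{j_0}>\log n\ge2^{j_0-1}$ and $2^{j_1}>n^\eta(\log n)^\alpha\ge2^{j_1-1}$. If $j_0\le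 j_1$, then $$\mathbb E\|\hat f_n-f\|^2\le C_1(\delta)\Big[\sum_{k=0}^{2^{j_0}-1}\sigma^2_{j_0,k}+\sum_{j=j_0}^{j_1}\sum_{k=0}^{2^j-1}\min\big(\beta_{j,k}^2,\log(n)\sigma^2_{j,k}\big)+\sum_{j=j_1+1}^{\infty}\sum_{k=0}^{2^j-1}\beta_{j,k}^2\Big]+C_2(\delta)\Gamma_{n,1},$$ where $$\Gamma_{n,1}=\frac{\log n}{n}\sum_{j=j_0}^{j_1}\sum_{k=0}^{2^j-1}\beta_{j,k}^2+\max(\|f\|_\infty,1)\max((\log n)^\alpha,1)\frac{(\log n)^\alpha}{n}+\frac{(\log n)^{2+2\alpha}}{n^{2(1-\eta)}} .$$ -/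

import Mathlib

open MeasureTheory ProbabilityTheory Filter Topology

noncomputable section

namespace MeyerDensity

/-- A Meyer low-pass filter `h̃`: a real, even, `2π`-periodic conjugate mirror filter of class `C²`
(in particular every smooth one) which equals `√2` on `[-π/3, π/3]`.
The quadrature identity then forces `h̃ = 0` for `2π/3 ≤ |ω| ≤ π`. -/
structure MeyerFilter where
  /-- the transfer function -/
  toFun : ℝ → ℝ
  contDiff : ContDiff ℝ 2 toFun
  periodic : Function.Periodic toFun (2 * Real.pi)
  even : ∀ ω, toFun (-ω) = toFun ω
  flat : ∀ ω, |ω| ≤ Real.pi / 3 → toFun ω = Real.sqrt 2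
  quadrature : ∀ ω, toFun ω ^ 2 + toFun (ω + Real.pi) ^ 2 = 2

namespace MeyerFilter

variable (h : MeyerFilter)

/-- Fourier transform `∫ φ*(x) e^{-iωx} dx` of the Meyer scaling function `φ*`. -/
def phiHat (ω : ℝ) : ℝ :=
  if |ω| ≤ 4 * Real.pi / 3 then h.toFun (ω / 2) / Real.sqrt 2 else 0

/-- Fourier transform of the Meyer mother wavelet `ψ*`: `2^{-1/2} g̃(ω/2) φ̃(ω/2)` with the
high-pass mirror filter `g̃(ω) = e^{-iω} h̃(ω + π)`. -/
def psiHat (ω : ℝ) : ℂ :=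
  Complex.exp (-(Complex.I * (ω / 2 : ℝ))) *
    ((h.toFun (ω / 2 + Real.pi) / Real.sqrt 2 * h.phiHat (ω / 2) : ℝ) : ℂ)

end MeyerFilter

/-- The function on `ℝ` whose Fourier transform (with kernel `e^{-iωx}`) is `F`, by Fourier
inversion; it is real for the two transforms used below, because `F (-ω)` is conjugate to `F ω`. -/
def ofFourier (F : ℝ → ℂ) (x : ℝ) : ℝ :=
  (1 / (2 * Real.pi)) * (∫ ω : ℝ, F ω * Complex.exp (Complex.I * (ω * x : ℝ))).re

/-- Periodized, dilated and translated function `2^{j/2} ∑_{i ∈ ℤ} g (2^j (x + i) - k)`. -/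
def periodize (g : ℝ → ℝ) (j k : ℕ) (x : ℝ) : ℝ :=
  (2 : ℝ) ^ ((j : ℝ) / 2) * ∑' i : ℤ, g (2 ^ j * (x + i) - k)

namespace MeyerFilter

variable (h : MeyerFilter)

/-- The Meyer scaling function `φ*`. -/
def scaling : ℝ → ℝ := ofFourier fun ω => (h.phiHat ω : ℂ)

/-- The Meyer mother wavelet `ψ*`. -/
def mother : ℝ → ℝ := ofFourier h.psiHat

/-- The periodized scaling function `φ_{j,k}`. -/
def phi (j k : ℕ) : ℝ → ℝ := periodize h.scaling j k

/-- The periodized wavelet `ψ_{j,k}`. -/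
def psi (j k : ℕ) : ℝ → ℝ := periodize h.mother j k

end MeyerFilter

/-- Fourier coefficient `⟨g, e_ℓ⟩ = ∫₀¹ g(u) e^{-2πiℓu} du`. -/
def fCoef (g : ℝ → ℝ) (ℓ : ℤ) : ℂ :=
  ∫ u in (0 : ℝ)..1, (g u : ℂ) * Complex.exp (-(2 * Real.pi * Complex.I * ℓ * u))

/-- The set of frequencies `{ℓ ∈ ℤ : g_ℓ ≠ 0}`; it is finite for `φ_{j,k}` and `ψ_{j,k}`. -/
def freqs (g : ℝ → ℝ) : Set ℤ := {ℓ | fCoef g ℓ ≠ 0}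

/-- The coefficient `⟨f, g⟩ = ∫₀¹ f(u) g(u) du`. -/
def coef (f g : ℝ → ℝ) : ℝ := ∫ u in (0 : ℝ)..1, f u * g u

section Sample

variable {n : ℕ} (X : Fin n → ℝ)

/-- Empirical coefficient `∑_ℓ conj(g_ℓ) (1/n ∑_m e^{-2πiℓX_m})`, the sum being over the
frequencies of `g`. (It is a real number, as `g` is real valued.) -/
def empCoef (g : ℝ → ℝ) : ℝ :=
  (∑ᶠ ℓ ∈ freqs g, (starRingEnd ℂ) (fCoef g ℓ) *
    ((1 / (n : ℂ)) * ∑ m, Complex.exp (-(2 * Real.pi * Complex.I * ℓ * X m)))).re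

/-- Empirical variance bound `V̂ = n⁻² ∑_m |∑_ℓ conj(g_ℓ) e^{-2πiℓX_m}|²`. -/
def empVar (g : ℝ → ℝ) : ℝ :=
  (1 / (n : ℝ) ^ 2) * ∑ m, ‖∑ᶠ ℓ ∈ freqs g, (starRingEnd ℂ) (fCoef g ℓ) *
    Complex.exp (-(2 * Real.pi * Complex.I * ℓ * X m))‖ ^ 2

/-- `∑_ℓ |g_ℓ|`, the number `η_j` for `g = ψ_{j,k}`. -/
def fourierL1 (g : ℝ → ℝ) : ℝ := ∑ᶠ ℓ ∈ freqs g, ‖fCoef g ℓ‖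

/-- The constant `κ = 4/3 + √(5/3)`. -/
def kappa : ℝ := 4 / 3 + Real.sqrt (5 / 3)

/-- The random threshold `τ`. -/
def threshold (δ : ℝ) (g : ℝ → ℝ) : ℝ :=
  Real.sqrt (2 * δ * Real.log n *
    (empVar X g
      + Real.sqrt (2 * δ * Real.log n * empVar X g * (fourierL1 g ^ 2 / (n : ℝ) ^ 2))
      + δ * Real.log n * kappa * (fourierL1 g ^ 2 / (n : ℝ) ^ 2)))
  + δ * Real.log n / (3 * n) * fourierL1 g

open Classical in
/-- The hard-thresholding estimator `f̂_n` computed from the sample `X`. -/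
def estimator (h : MeyerFilter) (δ : ℝ) (j₀ j₁ : ℕ) (x : ℝ) : ℝ :=
  ∑ k ∈ Finset.range (2 ^ j₀), empCoef X (h.phi j₀ k) * h.phi j₀ k x
  + ∑ j ∈ Finset.Icc j₀ j₁, ∑ k ∈ Finset.range (2 ^ j),
      if threshold X δ (h.psi j k) ≤ |empCoef X (h.psi j k)|
      then empCoef X (h.psi j k) * h.psi j k x else 0

end Sample

/-- The class `D²([0,1])` of square integrable probability densities on `[0,1]`. -/
structure IsL2Density (f : ℝ → ℝ) : Prop where
  memLp : MemLp f 2 (volume.restrict (Set.Icc 0 1))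
  nonneg : ∀ x ∈ Set.Icc (0 : ℝ) 1, 0 ≤ f x
  integral_eq_one : ∫ x in (0 : ℝ)..1, f x = 1

/-- `‖f‖_∞ < ∞` on `[0,1]`. -/
def BoundedOnUnit (f : ℝ → ℝ) : Prop := BddAbove (Set.range fun x : Set.Icc (0 : ℝ) 1 => |f x|)

/-- `‖f‖_∞ = sup_{x ∈ [0,1]} |f x|`. -/
def supNorm (f : ℝ → ℝ) : ℝ := ⨆ x : Set.Icc (0 : ℝ) 1, |f x|

/-- The probability measure on `ℝ` carried by `[0,1]` with density `f`. -/
def law (f : ℝ → ℝ) : Measure ℝ :=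
  (volume.restrict (Set.Icc 0 1)).withDensity fun x => ENNReal.ofReal (f x)

/-- `X₁, …, X_n` are independent random variables with common density `f` on `[0,1]`. -/
structure IsIIDSample {Ω : Type*} [MeasurableSpace Ω] (P : Measure Ω) (f : ℝ → ℝ) {n : ℕ}
    (X : Fin n → Ω → ℝ) : Prop where
  measurable : ∀ i, Measurable (X i)
  indep : iIndepFun X P
  map_eq : ∀ i, P.map (X i) = law f

section Risk

variable {Ω : Type*} [MeasurableSpace Ω] (P : Measure Ω) (f : ℝ → ℝ) {n : ℕ} (X : Fin n → Ω → ℝ)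

/-- Variance `E (ĝ - ⟨f, g⟩)²` of the empirical coefficient attached to `g`: this is
`σ²_{j₀,k}` for `g = φ_{j₀,k}` and `σ²_{j,k}` for `g = ψ_{j,k}`. -/
def coefVar (g : ℝ → ℝ) : ℝ :=
  ∫ ω, (empCoef (fun i => X i ω) g - coef f g) ^ 2 ∂P

/-- Quadratic risk `E ‖f̂_n - f‖²` in `L²([0,1])`. -/
def risk (h : MeyerFilter) (δ : ℝ) (j₀ j₁ : ℕ) : ENNReal :=
  ∫⁻ ω, eLpNorm (fun x => estimator (fun i => X i ω) h δ j₀ j₁ x - f x) 2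
    (volume.restrict (Set.Icc 0 1)) ^ 2 ∂P

/-- The oracle bound
`∑_k σ²_{j₀,k} + ∑_{j₀ ≤ j ≤ j₁} ∑_k min(β²_{j,k}, log n · σ²_{j,k}) + ∑_{j > j₁} ∑_k β²_{j,k}`. -/
def oracleBound (h : MeyerFilter) (j₀ j₁ : ℕ) : ℝ :=
  ∑ k ∈ Finset.range (2 ^ j₀), coefVar P f X (h.phi j₀ k)
  + ∑ j ∈ Finset.Icc j₀ j₁, ∑ k ∈ Finset.range (2 ^ j),
      min (coef f (h.psi j k) ^ 2) (Real.log n * coefVar P f X (h.psi j k))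
  + ∑' i : ℕ, ∑ k ∈ Finset.range (2 ^ (j₁ + 1 + i)), coef f (h.psi (j₁ + 1 + i) k) ^ 2

end Risk

/-- The remainder `Γ_{n,1}`. -/
def remainder (h : MeyerFilter) (η α : ℝ) (f : ℝ → ℝ) (n j₀ j₁ : ℕ) : ℝ :=
  Real.log n / n *
      ∑ j ∈ Finset.Icc j₀ j₁, ∑ k ∈ Finset.range (2 ^ j), coef f (h.psi j k) ^ 2
  + max (supNorm f) 1 * max (Real.log n ^ α) 1 * (Real.log n ^ α / n)
  + Real.log n ^ (2 + 2 * α) / (n : ℝ) ^ (2 * (1 - η))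

/-- `j` is the integer such that `2^j > x ≥ 2^{j-1}`. -/
def IsDyadicLevel (x : ℝ) (j : ℕ) : Prop := x < 2 ^ j ∧ (2 : ℝ) ^ ((j : ℤ) - 1) ≤ x

end MeyerDensity

end

/-!
The loss of the estimator is studied through its coefficients. In the frequency domain, `φ_{j,k}`
and `ψ_{j,k}` are trigonometric polynomials whose coefficients are samples of the Fourier transforms
of `φ*` and `ψ*` (Poisson summation, `IsBandLimited.periodize_eq`). Hence the empirical coefficients
are plain empirical means, and the numbers `η_j` bound the functions uniformly.

The sum over `k` of the squared coefficients of `f` at one scale is a quadratic form in the Fourier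
coefficients of `f`. The two-scale relation and the quadrature identity make the forms of `φ` and
`ψ` at scale `j` add up to the form of `φ` at scale `j + 1` (`MeyerFilter.frameKernel_add`), and the
latter tends to `∫ f²` (`MeyerFilter.tendsto_scalingEnergy`). So the periodized system is a Parseval
frame, which is all that is used of its orthonormality: synthesis is a contraction, and the loss is
at most twice the squared errors of the coefficients plus twice the energy of `f` at the discarded
scales (`MeyerFilter.eLpNorm_estimator_sub_le`).

For one coefficient `β` with empirical error `e`, fix `θ < 1`. If `|e| ≤ θτ`, the loss of hard
thresholding is at most a constant times `min(β², e²)` when the coefficient is kept and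
`min(β², 4τ²)` when it is discarded; otherwise the loss is `O(e²)` (`thresholded_sq_le`).
Bernstein's inequality, together with the lower tail of the empirical variance, gives
`P(|e| > θτ) ≤ 3 n^{-θ²δ}` (`IsIIDSample.error_tail`). The error also has a bounded
hyperbolic-cosine moment at its natural scale `s`, where `s² = E g² / n + η_j² / n²` for the
function `g = ψ_{j,k}`; interpolating between the two bounds shows that the expectation of `e²` on
the event `|e| > θτ` is `O(s² n^{-θ²δ(1-ε)})` (`IsIIDSample.exists_dominating_bad`). As `δ > η`, the
parameters can be chosen so that `θ²δ(1-ε) = η`, and the factor `n^{-η}` compensates for the number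
of coefficients, which is of order `n^η (log n)^α` (`sum_noise_le`). When `δ ↓ η` this forces
`θ → 1`, and the constants blow up.
-/

namespace MeyerDensity

open scoped FourierTransform

/-! ### Periodization of band-limited functions -/

/-- Two integrations by parts: the Fourier transform of a compactly supported `C²` function decays
quadratically. -/
lemma exists_norm_fourier_le {H : ℝ → ℂ} (hH : ContDiff ℝ 2 H) (hc : HasCompactSupport H) :
    ∃ C : ℝ, ∀ x, ‖𝓕 H x‖ ≤ C * (1 + x ^ 2)⁻¹ := by
  have hint : ∀ m : ℕ, (m : ℕ∞) ≤ (2 : ℕ∞) → Integrable (iteratedDeriv m H) := by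
    intro m hm
    refine (hH.continuous_iteratedDeriv m (by exact_mod_cast hm)).integrable_of_hasCompactSupport ?_
    rw [iteratedDeriv_eq_iterate]
    clear hm
    induction m with
    | zero => simpa using hc
    | succ m ih => rw [Function.iterate_succ_apply']; exact ih.deriv
  have h2 := Real.fourier_iteratedDeriv (N := 2) (n := 2) (by exact_mod_cast hH) hint le_rfl
  have b0 : ∀ x, ‖𝓕 H x‖ ≤ ∫ y, ‖H y‖ := fun x => by
    rw [Real.fourier_eq]
    refine (norm_integral_le_integral_norm _).trans (le_of_eq ?_)
    simp [Circle.norm_smul]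
  have b2 : ∀ x, ‖𝓕 (iteratedDeriv 2 H) x‖ ≤ ∫ y, ‖iteratedDeriv 2 H y‖ := fun x => by
    rw [Real.fourier_eq]
    refine (norm_integral_le_integral_norm _).trans (le_of_eq ?_)
    simp [Circle.norm_smul]
  refine ⟨(∫ y, ‖H y‖) + ∫ y, ‖iteratedDeriv 2 H y‖, fun x => ?_⟩
  have hx : (0 : ℝ) < 1 + x ^ 2 := by positivity
  rw [← div_eq_mul_inv, le_div_iff₀ hx, mul_add, mul_one]
  refine add_le_add (b0 x) (le_trans ?_ (b2 x))
  rw [h2]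
  simp only [norm_smul, norm_pow, norm_mul, Complex.norm_real, Complex.norm_I, Complex.norm_ofNat,
    Real.norm_eq_abs, abs_of_pos Real.pi_pos, mul_pow, sq_abs]
  have : (1 : ℝ) ≤ 2 ^ 2 * Real.pi ^ 2 := by nlinarith [Real.pi_gt_three]
  nlinarith [norm_nonneg (𝓕 H x), mul_nonneg (norm_nonneg (𝓕 H x)) (sq_nonneg x)]

/-- Poisson summation for a function with compactly supported `C²` Fourier transform. -/
lemma tsum_fourierInv_add {H : ℝ → ℂ} (hH : ContDiff ℝ 2 H) (hc : HasCompactSupport H) (x : ℝ)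
    {S : Finset ℤ} (hS : ∀ l : ℤ, l ∉ S → H l = 0) :
    ∑' i : ℤ, 𝓕⁻ H (x + i) = ∑ l ∈ S, H l * fourier l (x : UnitAddCircle) := by
  obtain ⟨C, hC⟩ := exists_norm_fourier_le hH hc
  have hint : Integrable H := hH.continuous.integrable_of_hasCompactSupport hc
  have hcont : Continuous (𝓕 H) :=
    VectorFourier.fourierIntegral_continuous Real.continuous_fourierChar
      (innerSL ℝ).continuous₂ hint
  have hFint : Integrable (𝓕 H) :=
    (integrable_inv_one_add_sq.const_mul C).mono' hcont.aestronglyMeasurable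
      (Eventually.of_forall hC)
  have hinv : 𝓕 (𝓕⁻ H) = H := hH.continuous.fourier_fourierInv_eq hint hFint
  have hcont' : Continuous (𝓕⁻ H) := by
    have : 𝓕⁻ H = fun x => 𝓕 H (-x) := funext fun x => Real.fourierInv_eq_fourier_neg H x
    rw [this]; exact hcont.comp continuous_neg
  have hdec : 𝓕⁻ H =O[cocompact ℝ] fun x : ℝ => |x| ^ (-2 : ℝ) := by
    refine Asymptotics.IsBigO.of_bound |C| ?_
    have : ∀ᶠ x : ℝ in cocompact ℝ, x ≠ 0 := by
      filter_upwards [(isCompact_singleton (x := (0 : ℝ))).compl_mem_cocompact] with x hx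
      simpa using hx
    filter_upwards [this] with x hx
    rw [Real.fourierInv_eq_fourier_neg]
    refine (hC (-x)).trans ?_
    have hx2 : 0 < x ^ 2 := by positivity
    rw [Real.rpow_neg (abs_nonneg x), Real.rpow_two, sq_abs, norm_inv, Real.norm_eq_abs,
      abs_of_pos hx2, neg_sq]
    refine mul_le_mul (le_abs_self C) ?_ (by positivity) (abs_nonneg C)
    exact inv_anti₀ hx2 (by linarith)
  have hsum : Summable fun n : ℤ => 𝓕 (𝓕⁻ H) n := by
    rw [hinv]
    exact summable_of_ne_finset_zero (s := S) fun l hl => hS l hl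
  rw [Real.tsum_eq_tsum_fourier_of_rpow_decay_of_summable hcont' one_lt_two hdec hsum, hinv]
  exact tsum_eq_sum fun l hl => by rw [hS l hl, zero_mul]

/-- The Fourier transform of a scaling function or wavelet: a `C²` function supported in
`|ω| < 4π`, bounded by one, and Hermitian, so that the inverse transform is real. -/
structure IsBandLimited (F : ℝ → ℂ) : Prop where
  contDiff : ContDiff ℝ 2 F
  eq_zero : ∀ ω, 4 * Real.pi ≤ |ω| → F ω = 0
  hermitian : ∀ ω, F (-ω) = (starRingEnd ℂ) (F ω)
  norm_le_one : ∀ ω, ‖F ω‖ ≤ 1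

/-- The character `e^{2πiℓx}` of frequency `ℓ`. -/
noncomputable def char (l : ℤ) (x : ℝ) : ℂ := Complex.exp (2 * Real.pi * Complex.I * l * x)

/-- Fourier coefficients of the periodization at scale `j` and position `k` of the function with
Fourier transform `F`. -/
noncomputable def levelCoef (F : ℝ → ℂ) (j k : ℕ) (l : ℤ) : ℂ :=
  ((2 : ℝ) ^ (-(j : ℝ) / 2) : ℝ) * F (2 * Real.pi * l / 2 ^ j) * char (-l) (k / 2 ^ j)

/-- A range of frequencies containing the spectrum of all functions of scale `j`. -/
noncomputable def band (j : ℕ) : Finset ℤ := Finset.Icc (-(2 * 2 ^ j)) (2 * 2 ^ j)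

lemma char_eq_fourier (l : ℤ) (x : ℝ) : char l x = fourier l (x : UnitAddCircle) := by
  rw [char, fourier_coe_apply]; congr 1; push_cast; ring

lemma char_zero (x : ℝ) : char 0 x = 1 := by simp [char]

lemma char_add (l m : ℤ) (x : ℝ) : char (l + m) x = char l x * char m x := by
  rw [char, char, char, ← Complex.exp_add]; congr 1; push_cast; ring

lemma conj_char (l : ℤ) (x : ℝ) : (starRingEnd ℂ) (char l x) = char (-l) x := by
  rw [char, char, ← Complex.exp_conj]; congr 1
  simp only [map_mul, Complex.conj_ofReal, Complex.conj_I, map_intCast, map_ofNat]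
  push_cast; ring

lemma norm_char (l : ℤ) (x : ℝ) : ‖char l x‖ = 1 := by
  rw [char, show 2 * (Real.pi : ℂ) * Complex.I * l * x
    = ((2 * Real.pi * l * x : ℝ) : ℂ) * Complex.I by push_cast; ring]
  exact Complex.norm_exp_ofReal_mul_I _

lemma continuous_char (l : ℤ) : Continuous (char l) := by unfold char; fun_prop

lemma IsBandLimited.eq_zero_of_notMem_band {F : ℝ → ℂ} (hF : IsBandLimited F) {j : ℕ} {l : ℤ}
    (hl : l ∉ band j) : F (2 * Real.pi * l / 2 ^ j) = 0 := by
  apply hF.eq_zero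
  have h1 : (2 * 2 ^ j : ℤ) ≤ |l| := by
    by_contra! h
    exact hl (Finset.mem_Icc.2 (abs_le.1 h.le))
  have h2 : (2 * 2 ^ j : ℝ) ≤ |(l : ℝ)| := by exact_mod_cast h1
  rw [abs_div, abs_mul, abs_of_pos Real.two_pi_pos, abs_of_pos (by positivity : (0 : ℝ) < 2 ^ j),
    le_div_iff₀ (by positivity)]
  nlinarith [Real.pi_pos]

lemma IsBandLimited.levelCoef_eq_zero {F : ℝ → ℂ} (hF : IsBandLimited F) {j k : ℕ} {l : ℤ}
    (hl : l ∉ band j) : levelCoef F j k l = 0 := by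
  rw [levelCoef, hF.eq_zero_of_notMem_band hl]; simp

/-- The inverse transform of a Hermitian function is real, so that the real part taken in
`ofFourier` loses nothing. -/
lemma IsBandLimited.ofFourier_eq {F : ℝ → ℂ} (hF : IsBandLimited F) (x : ℝ) :
    (ofFourier F x : ℂ) =
      (1 / (2 * Real.pi)) * ∫ ω : ℝ, F ω * Complex.exp (Complex.I * (ω * x : ℝ)) := by
  have hreal : (starRingEnd ℂ) (∫ ω : ℝ, F ω * Complex.exp (Complex.I * (ω * x : ℝ)))
      = ∫ ω : ℝ, F ω * Complex.exp (Complex.I * (ω * x : ℝ)) := by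
    rw [← integral_conj, ← integral_neg_eq_self]
    congr 1; ext ω
    rw [hF.hermitian, map_mul, Complex.conj_conj, ← Complex.exp_conj]
    congr 2
    simp [Complex.conj_ofReal]
  rw [ofFourier, Complex.ofReal_mul, Complex.conj_eq_iff_re.1 hreal]
  push_cast
  rfl

/-- The periodized function is the trigonometric polynomial with the coefficients `levelCoef`. -/
lemma IsBandLimited.periodize_eq {F : ℝ → ℂ} (hF : IsBandLimited F) (j k : ℕ) (x : ℝ) :
    (periodize (ofFourier F) j k x : ℂ) = ∑ l ∈ band j, levelCoef F j k l * char l x := by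
  have hj : (0 : ℝ) < 2 ^ j := by positivity
  -- the substitution `ω = 2πξ / 2^j` puts the dilated function into the form `𝓕⁻ H`
  set H : ℝ → ℂ := fun ξ => ((2 ^ j : ℝ)⁻¹ : ℂ) * F (2 * Real.pi / 2 ^ j * ξ) *
    Complex.exp (-(2 * Real.pi * Complex.I * k / 2 ^ j) * ξ) with hHdef
  have hHc : ContDiff ℝ 2 H := by
    refine (contDiff_const.mul (hF.contDiff.comp (contDiff_const.mul contDiff_id))).mul ?_
    exact (contDiff_const.mul Complex.ofRealCLM.contDiff).cexp
  have hHs : HasCompactSupport H := by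
    refine HasCompactSupport.intro (isCompact_Icc (a := -(2 * 2 ^ j : ℝ)) (b := 2 * 2 ^ j)) ?_
    intro ξ hξ
    have h1 : (2 * 2 ^ j : ℝ) ≤ |ξ| := by
      by_contra! h
      exact hξ (abs_le.1 h.le)
    have : F (2 * Real.pi / 2 ^ j * ξ) = 0 := by
      apply hF.eq_zero
      rw [abs_mul, abs_of_pos (by positivity : 0 < 2 * Real.pi / 2 ^ j), div_mul_eq_mul_div,
        le_div_iff₀ hj]
      nlinarith [Real.pi_pos]
    simp [hHdef, this]
  have key : ∀ y : ℝ, (ofFourier F (2 ^ j * y - k) : ℂ) = 𝓕⁻ H y := by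
    intro y
    rw [hF.ofFourier_eq, Real.fourierInv_eq']
    have hs := Measure.integral_comp_mul_left (fun ω : ℝ => F ω *
      Complex.exp (Complex.I * (ω * (2 ^ j * y - k) : ℝ))) (2 * Real.pi / 2 ^ j)
    have hpos : (0 : ℝ) < 2 * Real.pi / 2 ^ j := by positivity
    rw [abs_of_pos (inv_pos.2 hpos)] at hs
    have hs' : (∫ ω : ℝ, F ω * Complex.exp (Complex.I * (ω * (2 ^ j * y - k) : ℝ))) =
        ((2 * Real.pi / 2 ^ j : ℝ) : ℂ) * ∫ ξ : ℝ, F (2 * Real.pi / 2 ^ j * ξ) *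
          Complex.exp (Complex.I * ((2 * Real.pi / 2 ^ j * ξ) * (2 ^ j * y - k) : ℝ)) := by
      rw [hs, Complex.real_smul, ← mul_assoc, ← Complex.ofReal_mul, mul_inv_cancel₀ hpos.ne',
        Complex.ofReal_one, one_mul]
    rw [hs', ← integral_const_mul, ← integral_const_mul]
    congr 1; ext ξ
    have e : Complex.exp (Complex.I * ((2 * Real.pi / 2 ^ j * ξ) * (2 ^ j * y - k) : ℝ))
        = Complex.exp (↑(2 * Real.pi * inner ℝ ξ y) * Complex.I) *
          Complex.exp (-(2 * Real.pi * Complex.I * k / 2 ^ j) * ξ) := by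
      rw [← Complex.exp_add]; congr 1
      simp only [RCLike.inner_apply, conj_trivial]
      push_cast
      have : (2 : ℂ) ^ j ≠ 0 := pow_ne_zero _ two_ne_zero
      field_simp
      ring
    rw [e, hHdef, smul_eq_mul]
    have : (2 : ℂ) ^ j ≠ 0 := pow_ne_zero _ two_ne_zero
    have : (Real.pi : ℂ) ≠ 0 := by exact_mod_cast Real.pi_pos.ne'
    push_cast
    field_simp
  have hHint : ∀ l : ℤ, H l = ((2 ^ j : ℝ)⁻¹ : ℂ) * F (2 * Real.pi * l / 2 ^ j) *
      char (-l) (k / 2 ^ j) := by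
    intro l
    simp only [hHdef, char]
    congr 2
    · congr 1; ring_nf
    · push_cast; ring_nf
  have hP := tsum_fourierInv_add hHc hHs x (S := band j) fun l hl => by
    rw [hHint, hF.eq_zero_of_notMem_band hl]; simp
  rw [periodize, Complex.ofReal_mul, Complex.ofReal_tsum]
  simp_rw [key]
  rw [hP, Finset.mul_sum]
  refine Finset.sum_congr rfl fun l _ => ?_
  rw [hHint, ← char_eq_fourier, levelCoef]
  have hpow : ((2 : ℝ) ^ ((j : ℝ) / 2) : ℝ) * ((2 : ℝ) ^ j)⁻¹ = (2 : ℝ) ^ (-(j : ℝ) / 2) := by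
    rw [← Real.rpow_natCast, ← Real.rpow_neg (by norm_num), ← Real.rpow_add (by norm_num)]
    congr 1; ring
  rw [← hpow]
  push_cast
  ring

/-! ### Real trigonometric polynomials and their empirical coefficients -/

lemma integral_char (l : ℤ) : ∫ u in (0 : ℝ)..1, char l u = if l = 0 then 1 else 0 := by
  split_ifs with h
  · simp [h, char_zero]
  · have hc : 2 * (Real.pi : ℂ) * Complex.I * l ≠ 0 := by
      simp [Real.pi_ne_zero, h]
    simp_rw [char]
    rw [integral_exp_mul_complex hc]
    have : Complex.exp (2 * Real.pi * Complex.I * l * (1 : ℝ)) = 1 := by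
      rw [Complex.exp_eq_one_iff]; exact ⟨l, by push_cast; ring⟩
    rw [this]; simp

lemma fCoef_eq (g : ℝ → ℝ) (l : ℤ) : fCoef g l = ∫ u in (0 : ℝ)..1, (g u : ℂ) * char (-l) u := by
  rw [fCoef]; congr 1; ext u; rw [char]; congr 2; push_cast; ring

/-- A real function which is the sum of its Fourier series, all frequencies lying in `S`. -/
structure IsTrigPoly (g : ℝ → ℝ) (S : Finset ℤ) : Prop where
  eq_sum : ∀ x, (g x : ℂ) = ∑ l ∈ S, fCoef g l * char l x
  eq_zero : ∀ l, l ∉ S → fCoef g l = 0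

lemma fCoef_of_eq_sum {g : ℝ → ℝ} {S : Finset ℤ} {c : ℤ → ℂ}
    (h : ∀ x, (g x : ℂ) = ∑ l ∈ S, c l * char l x) (m : ℤ) :
    fCoef g m = if m ∈ S then c m else 0 := by
  rw [fCoef_eq]
  simp_rw [h, Finset.sum_mul, mul_assoc, ← char_add]
  rw [intervalIntegral.integral_finsetSum fun l _ =>
    ((continuous_char (l + -m)).intervalIntegrable _ _).const_mul (c l)]
  simp_rw [intervalIntegral.integral_const_mul, integral_char]
  have : ∀ l : ℤ, (l + -m = 0) ↔ (m = l) := fun l => by omega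
  simp [this]

lemma IsBandLimited.fCoef_periodize {F : ℝ → ℂ} (hF : IsBandLimited F) (j k : ℕ) (l : ℤ) :
    fCoef (periodize (ofFourier F) j k) l = levelCoef F j k l := by
  rw [fCoef_of_eq_sum (hF.periodize_eq j k)]
  split_ifs with h
  · rfl
  · rw [hF.levelCoef_eq_zero h]

lemma IsBandLimited.isTrigPoly {F : ℝ → ℂ} (hF : IsBandLimited F) (j k : ℕ) :
    IsTrigPoly (periodize (ofFourier F) j k) (band j) where
  eq_sum x := by simp_rw [hF.fCoef_periodize]; exact hF.periodize_eq j k x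
  eq_zero l hl := by rw [hF.fCoef_periodize, hF.levelCoef_eq_zero hl]

namespace IsTrigPoly

variable {g : ℝ → ℝ} {S : Finset ℤ} (hg : IsTrigPoly g S)
include hg

lemma finsum_freqs {M : Type*} [AddCommMonoid M] (F : ℤ → M) (hF : ∀ l, fCoef g l = 0 → F l = 0) :
    ∑ᶠ l ∈ freqs g, F l = ∑ l ∈ S, F l := by
  have h1 : ∀ l, (∑ᶠ _ : l ∈ freqs g, F l) = F l := fun l => by
    by_cases h : l ∈ freqs g
    · simp [h]
    · classical rw [finsum_eq_if, if_neg h]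
      exact (hF l (by simpa [freqs] using h)).symm
  simp_rw [h1]
  refine finsum_eq_sum_of_support_subset _ fun l hl => ?_
  by_contra h
  exact hl (hF l (hg.eq_zero l h))

lemma continuous : Continuous g := by
  have : g = fun x => (∑ l ∈ S, fCoef g l * char l x).re :=
    funext fun x => by rw [← hg.eq_sum, Complex.ofReal_re]
  rw [this]
  exact Complex.continuous_re.comp
    (continuous_finsetSum _ fun l _ => continuous_const.mul (continuous_char l))

/-- As `g` is real, conjugating its Fourier series changes nothing. -/
lemma sum_conj (x : ℝ) :
    ∑ l ∈ S, (starRingEnd ℂ) (fCoef g l) * Complex.exp (-(2 * Real.pi * Complex.I * l * x))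
      = (g x : ℂ) := by
  rw [← Complex.conj_ofReal (g x), hg.eq_sum, map_sum]
  refine Finset.sum_congr rfl fun l _ => ?_
  rw [map_mul, conj_char, char]
  congr 2; push_cast; ring

lemma finsum_conj (x : ℝ) :
    ∑ᶠ l ∈ freqs g, (starRingEnd ℂ) (fCoef g l) *
      Complex.exp (-(2 * Real.pi * Complex.I * l * x)) = (g x : ℂ) := by
  rw [hg.finsum_freqs _ fun l hl => by simp [hl], hg.sum_conj]

lemma empCoef_eq {n : ℕ} (X : Fin n → ℝ) : empCoef X g = (1 / n : ℝ) * ∑ m, g (X m) := by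
  rw [empCoef, hg.finsum_freqs _ fun l hl => by simp [hl]]
  have : ∑ l ∈ S, (starRingEnd ℂ) (fCoef g l) * ((1 / (n : ℂ)) *
      ∑ m, Complex.exp (-(2 * Real.pi * Complex.I * l * X m)))
      = (((1 / n : ℝ) * ∑ m, g (X m) : ℝ) : ℂ) := by
    push_cast
    simp_rw [← hg.sum_conj, Finset.mul_sum]
    rw [Finset.sum_comm]
    refine Finset.sum_congr rfl fun m _ => Finset.sum_congr rfl fun l _ => by ring
  rw [this, Complex.ofReal_re]

lemma empVar_eq {n : ℕ} (X : Fin n → ℝ) : empVar X g = (1 / (n : ℝ) ^ 2) * ∑ m, g (X m) ^ 2 := by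
  rw [empVar]
  simp_rw [hg.finsum_conj, Complex.norm_real, Real.norm_eq_abs, sq_abs]

lemma fourierL1_eq : fourierL1 g = ∑ l ∈ S, ‖fCoef g l‖ :=
  hg.finsum_freqs _ fun l hl => by simp [hl]

lemma fourierL1_nonneg : 0 ≤ fourierL1 g := by
  rw [hg.fourierL1_eq]; exact Finset.sum_nonneg fun _ _ => norm_nonneg _

lemma abs_le_fourierL1 (x : ℝ) : |g x| ≤ fourierL1 g := by
  rw [← Real.norm_eq_abs, ← Complex.norm_real, hg.eq_sum, hg.fourierL1_eq]
  refine (norm_sum_le _ _).trans (le_of_eq ?_)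
  simp [norm_char]

end IsTrigPoly

lemma IsBandLimited.norm_levelCoef_le {F : ℝ → ℂ} (hF : IsBandLimited F) (j k : ℕ) (l : ℤ) :
    ‖levelCoef F j k l‖ ≤ (2 : ℝ) ^ (-(j : ℝ) / 2) := by
  rw [levelCoef, norm_mul, norm_mul, norm_char, mul_one, Complex.norm_real, Real.norm_eq_abs,
    abs_of_pos (by positivity)]
  exact mul_le_of_le_one_right (by positivity) (hF.norm_le_one _)

lemma IsBandLimited.fourierL1_sq_le {F : ℝ → ℂ} (hF : IsBandLimited F) (j k : ℕ) :
    fourierL1 (periodize (ofFourier F) j k) ^ 2 ≤ 25 * 2 ^ j := by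
  have h0 := (hF.isTrigPoly j k).fourierL1_nonneg
  have hcard : ((band j).card : ℝ) ≤ 5 * 2 ^ j := by
    have : ((band j).card : ℤ) = 4 * 2 ^ j + 1 := by
      have hp : (0 : ℤ) < 2 ^ j := by positivity
      rw [band, Int.card_Icc, Int.toNat_of_nonneg (by linarith)]; ring
    have h1 : (1 : ℝ) ≤ 2 ^ j := one_le_pow₀ (by norm_num)
    have h2 : ((band j).card : ℝ) = 4 * 2 ^ j + 1 := by exact_mod_cast this
    linarith
  have h1 : fourierL1 (periodize (ofFourier F) j k) ≤ (5 * 2 ^ j) * (2 : ℝ) ^ (-(j : ℝ) / 2) := by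
    rw [(hF.isTrigPoly j k).fourierL1_eq]
    refine (Finset.sum_le_card_nsmul _ _ ((2 : ℝ) ^ (-(j : ℝ) / 2)) fun l _ => ?_).trans ?_
    · rw [hF.fCoef_periodize]; exact hF.norm_levelCoef_le j k l
    · rw [nsmul_eq_mul]; exact mul_le_mul_of_nonneg_right hcard (by positivity)
  have h2 : ((2 : ℝ) ^ (-(j : ℝ) / 2)) ^ 2 = (2 ^ j)⁻¹ := by
    rw [← Real.rpow_natCast, ← Real.rpow_mul (by norm_num), ← Real.rpow_natCast,
      ← Real.rpow_neg (by norm_num)]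
    congr 1; push_cast; ring
  calc _ ≤ ((5 * 2 ^ j) * (2 : ℝ) ^ (-(j : ℝ) / 2)) ^ 2 := pow_le_pow_left₀ h0 h1 2
    _ = 25 * 2 ^ j := by
      rw [mul_pow, h2]; field_simp; norm_num

/-! ### The Meyer filter, scaling function and wavelet in the frequency domain -/

namespace MeyerFilter

variable (h : MeyerFilter)

lemma abs_toFun_le (ω : ℝ) : |h.toFun ω| ≤ Real.sqrt 2 := by
  rw [← Real.sqrt_sq_eq_abs]
  exact Real.sqrt_le_sqrt (by linarith [h.quadrature ω, sq_nonneg (h.toFun (ω + Real.pi))])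

lemma toFun_eq_zero {ω : ℝ} (h1 : 2 * Real.pi / 3 ≤ |ω|) (h2 : |ω| ≤ 4 * Real.pi / 3) :
    h.toFun ω = 0 := by
  wlog hω : 0 ≤ ω generalizing ω
  · rw [← h.even]
    exact this (by rwa [abs_neg]) (by rwa [abs_neg]) (by linarith)
  rw [abs_of_nonneg hω] at h1 h2
  have hq := h.quadrature (ω - Real.pi)
  rw [h.flat (ω - Real.pi) (by rw [abs_le]; constructor <;> linarith), sub_add_cancel,
    Real.sq_sqrt (by norm_num)] at hq
  exact pow_eq_zero_iff two_ne_zero |>.1 (by linarith)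

lemma phiHat_eq {ω : ℝ} (hω : |ω| < 8 * Real.pi / 3) :
    h.phiHat ω = h.toFun (ω / 2) / Real.sqrt 2 := by
  rw [phiHat]
  split_ifs with h1
  · rfl
  · rw [h.toFun_eq_zero, zero_div]
    · rw [abs_div, abs_two]; linarith
    · rw [abs_div, abs_two]; linarith

lemma phiHat_eq_zero {ω : ℝ} (hω : 4 * Real.pi / 3 ≤ |ω|) : h.phiHat ω = 0 := by
  by_cases h2 : |ω| < 8 * Real.pi / 3
  · rw [h.phiHat_eq h2, h.toFun_eq_zero, zero_div]
    · rw [abs_div, abs_two]; linarith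
    · rw [abs_div, abs_two]; linarith
  · rw [phiHat, if_neg]; linarith [Real.pi_pos]

lemma phiHat_eq_one {ω : ℝ} (hω : |ω| ≤ 2 * Real.pi / 3) : h.phiHat ω = 1 := by
  rw [h.phiHat_eq (by linarith [Real.pi_pos]), h.flat, div_self (by positivity)]
  rw [abs_div, abs_two]; linarith

lemma abs_phiHat_le (ω : ℝ) : |h.phiHat ω| ≤ 1 := by
  rw [phiHat]
  split_ifs
  · rw [abs_div, abs_of_pos (by positivity : 0 < Real.sqrt 2)]
    exact div_le_one_of_le₀ (h.abs_toFun_le _) (by positivity)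
  · simp

lemma contDiff_phiHat : ContDiff ℝ 2 h.phiHat := by
  rw [contDiff_iff_contDiffAt]
  intro ω
  rcases lt_or_ge |ω| (8 * Real.pi / 3) with hω | hω
  · have hc : ContDiff ℝ 2 fun ω => h.toFun (ω / 2) / Real.sqrt 2 :=
      (h.contDiff.comp (contDiff_id.div_const 2)).div_const _
    refine hc.contDiffAt.congr_of_eventuallyEq ?_
    filter_upwards [continuous_abs.continuousAt.eventually_lt continuousAt_const hω] with x hx
    exact h.phiHat_eq hx
  · refine (contDiffAt_const (c := (0 : ℝ))).congr_of_eventuallyEq ?_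
    have : 4 * Real.pi / 3 < |ω| := by linarith [Real.pi_pos]
    filter_upwards [continuousAt_const.eventually_lt continuous_abs.continuousAt this] with x hx
    exact h.phiHat_eq_zero hx.le

lemma isBandLimited_phiHat : IsBandLimited fun ω => (h.phiHat ω : ℂ) where
  contDiff := Complex.ofRealCLM.contDiff.comp h.contDiff_phiHat
  eq_zero ω hω := by
    rw [h.phiHat_eq_zero (by linarith [Real.pi_pos]), Complex.ofReal_zero]
  hermitian ω := by
    rw [Complex.conj_ofReal, phiHat, phiHat, abs_neg, neg_div, h.even]
  norm_le_one ω := by rw [Complex.norm_real]; exact h.abs_phiHat_le ω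

lemma isBandLimited_psiHat : IsBandLimited h.psiHat where
  contDiff := by
    refine ContDiff.mul ?_ (Complex.ofRealCLM.contDiff.comp (ContDiff.mul ?_ ?_))
    · exact ((contDiff_const.mul (Complex.ofRealCLM.contDiff.comp
        (contDiff_id.div_const 2))).neg).cexp
    · exact (h.contDiff.comp ((contDiff_id.div_const 2).add contDiff_const)).div_const _
    · exact h.contDiff_phiHat.comp (contDiff_id.div_const 2)
  eq_zero ω hω := by
    rw [psiHat, h.phiHat_eq_zero (ω := ω / 2), mul_zero, Complex.ofReal_zero, mul_zero]
    rw [abs_div, abs_two]; linarith [Real.pi_pos]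
  hermitian ω := by
    have h1 : h.toFun (-ω / 2 + Real.pi) = h.toFun (ω / 2 + Real.pi) := by
      rw [← h.even, ← h.periodic]; congr 1; ring
    have h2 : h.phiHat (-ω / 2) = h.phiHat (ω / 2) := by
      rw [phiHat, phiHat, neg_div, abs_neg, neg_div, h.even]
    rw [psiHat, psiHat, map_mul, Complex.conj_ofReal, h1, h2, ← Complex.exp_conj]
    congr 2
    simp only [map_neg, map_mul, Complex.conj_ofReal, Complex.conj_I]
    push_cast; ring
  norm_le_one ω := by
    have h1 : |h.toFun (ω / 2 + Real.pi) / Real.sqrt 2| ≤ 1 := by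
      rw [abs_div, abs_of_pos (by positivity : 0 < Real.sqrt 2)]
      exact div_le_one_of_le₀ (h.abs_toFun_le _) (by positivity)
    rw [psiHat, norm_mul, Complex.norm_real, Real.norm_eq_abs, abs_mul,
      show -(Complex.I * (ω / 2 : ℝ)) = ((-(ω / 2) : ℝ) : ℂ) * Complex.I by push_cast; ring,
      Complex.norm_exp_ofReal_mul_I, one_mul]
    exact mul_le_one₀ h1 (abs_nonneg _) (h.abs_phiHat_le _)

/-- Two-scale relation of the scaling function. -/
lemma phiHat_two_mul (ω : ℝ) : h.phiHat (2 * ω) = h.toFun ω / Real.sqrt 2 * h.phiHat ω := by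
  rcases le_or_gt |ω| (2 * Real.pi / 3) with hω | hω
  · rw [h.phiHat_eq_one hω, mul_one, h.phiHat_eq, mul_div_cancel_left₀ _ two_ne_zero]
    rw [abs_mul, abs_two]; linarith [Real.pi_pos]
  · rw [h.phiHat_eq_zero (ω := 2 * ω) (by rw [abs_mul, abs_two]; linarith)]
    rcases le_or_gt |ω| (4 * Real.pi / 3) with h2 | h2
    · rw [h.toFun_eq_zero hω.le h2]; simp
    · rw [h.phiHat_eq_zero h2.le, mul_zero]

lemma psiHat_two_mul (ω : ℝ) : h.psiHat (2 * ω) = Complex.exp (-(Complex.I * ω)) *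
    ((h.toFun (ω + Real.pi) / Real.sqrt 2 * h.phiHat ω : ℝ) : ℂ) := by
  rw [psiHat, mul_div_cancel_left₀ _ (two_ne_zero' ℝ)]

end MeyerFilter

/-! ### The periodized Meyer system is a Parseval frame -/

/-- Square integrability on the unit interval. -/
abbrev IsL2 (f : ℝ → ℝ) : Prop := MemLp f 2 (volume.restrict (Set.Icc 0 1))

lemma IsL2.memLp_Ioc {f : ℝ → ℝ} (hf : IsL2 f) : MemLp f 2 (volume.restrict (Set.Ioc 0 1)) :=
  hf.mono_measure (Measure.restrict_mono Set.Ioc_subset_Icc_self le_rfl)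

lemma IsL2.intervalIntegrable {f : ℝ → ℝ} (hf : IsL2 f) : IntervalIntegrable f volume 0 1 := by
  rw [intervalIntegrable_iff_integrableOn_Ioc_of_le zero_le_one]
  exact hf.memLp_Ioc.integrable one_le_two

lemma isL2_of_continuous {g : ℝ → ℝ} (hg : Continuous g) : IsL2 g := by
  obtain ⟨C, hC⟩ := isCompact_Icc.exists_bound_of_continuousOn (hg.continuousOn (s := Set.Icc 0 1))
  exact MemLp.of_bound hg.aestronglyMeasurable C
    ((ae_restrict_iff' measurableSet_Icc).2 (Eventually.of_forall hC))

lemma IsL2.intervalIntegrable_mul {f g : ℝ → ℝ} (hf : IsL2 f) (hg : IsL2 g) :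
    IntervalIntegrable (fun x => f x * g x) volume 0 1 := by
  rw [intervalIntegrable_iff_integrableOn_Ioc_of_le zero_le_one]
  exact hf.memLp_Ioc.integrable_mul hg.memLp_Ioc

lemma IsTrigPoly.coef_eq {f g : ℝ → ℝ} {S : Finset ℤ} (hg : IsTrigPoly g S) (hf : IsL2 f) :
    (coef f g : ℂ) = ∑ l ∈ S, (starRingEnd ℂ) (fCoef g l) * fCoef f l := by
  rw [coef, ← intervalIntegral.integral_ofReal]
  have h1 : ∀ x : ℝ, ((f x * g x : ℝ) : ℂ) =
      ∑ l ∈ S, (starRingEnd ℂ) (fCoef g l) * ((f x : ℂ) * char (-l) x) := fun x => by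
    rw [Complex.ofReal_mul, ← hg.sum_conj, Finset.mul_sum]
    refine Finset.sum_congr rfl fun l _ => ?_
    rw [char]
    push_cast
    ring_nf
  simp_rw [h1]
  have hi : ∀ l : ℤ, IntervalIntegrable (fun x => (f x : ℂ) * char (-l) x) volume 0 1 := fun l =>
    IntervalIntegrable.mul_continuousOn
      ⟨hf.intervalIntegrable.1.ofReal, hf.intervalIntegrable.2.ofReal⟩
      (continuous_char _).continuousOn
  rw [intervalIntegral.integral_finsetSum fun l _ => (hi l).const_mul _]
  simp_rw [intervalIntegral.integral_const_mul, fCoef_eq f]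

/-- Parseval's identity for the Fourier coefficients on `[0,1]`. -/
lemma IsL2.hasSum_sq_fCoef {f : ℝ → ℝ} (hf : IsL2 f) :
    HasSum (fun l : ℤ => ‖fCoef f l‖ ^ 2) (∫ x in (0 : ℝ)..1, f x ^ 2) := by
  have h := hasSum_sq_fourierCoeffOn (f := fun x => (f x : ℂ)) zero_lt_one hf.memLp_Ioc.ofReal
  convert h using 1
  · ext l
    rw [fourierCoeffOn_eq_integral, fCoef_eq]
    congr 2
    simp only [sub_zero, div_one, one_smul, smul_eq_mul]
    congr 1; ext x
    rw [mul_comm, char, fourier_coe_apply]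
    congr 2; push_cast; ring
  · simp

/-- Orthogonality of the characters of `ℤ / 2^j`. -/
lemma sum_char_dyadic (j : ℕ) (m : ℤ) : ∑ k ∈ Finset.range (2 ^ j), char m (k / 2 ^ j) =
    if (2 ^ j : ℤ) ∣ m then (2 ^ j : ℂ) else 0 := by
  have h2 : (2 : ℂ) ^ j ≠ 0 := pow_ne_zero _ two_ne_zero
  have hpow : ∀ k : ℕ, char m (k / 2 ^ j) = Complex.exp (2 * Real.pi * Complex.I * m / 2 ^ j) ^ k :=
    fun k => by rw [char, ← Complex.exp_nat_mul]; congr 1; push_cast; ring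
  simp_rw [hpow]
  split_ifs with h
  · obtain ⟨q, rfl⟩ := h
    have : Complex.exp (2 * Real.pi * Complex.I * ((2 ^ j * q : ℤ) : ℂ) / 2 ^ j) = 1 := by
      rw [Complex.exp_eq_one_iff]; exact ⟨q, by push_cast; field_simp⟩
    rw [this]; simp
  · have hne : Complex.exp (2 * Real.pi * Complex.I * m / 2 ^ j) ≠ 1 := by
      rw [Ne, Complex.exp_eq_one_iff]
      rintro ⟨q, hq⟩
      apply h
      refine ⟨q, ?_⟩
      have hpi : 2 * (Real.pi : ℂ) * Complex.I ≠ 0 := Complex.two_pi_I_ne_zero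
      rw [div_eq_iff h2] at hq
      have h3 : 2 * (Real.pi : ℂ) * Complex.I * m = 2 * Real.pi * Complex.I * (2 ^ j * q) := by
        rw [hq]; ring
      exact_mod_cast mul_left_cancel₀ hpi h3
    rw [geom_sum_eq hne]
    have : Complex.exp (2 * Real.pi * Complex.I * m / 2 ^ j) ^ (2 ^ j) = 1 := by
      rw [← Complex.exp_nat_mul, Complex.exp_eq_one_iff]
      exact ⟨m, by push_cast; field_simp⟩
    rw [this]; simp

/-- Kernel, in the frequency domain, of the frame operator of scale `j` generated by the function
with Fourier transform `F`. -/
noncomputable def frameKernel (F : ℝ → ℂ) (j : ℕ) (l m : ℤ) : ℂ :=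
  if (2 ^ j : ℤ) ∣ l - m then
    (starRingEnd ℂ) (F (2 * Real.pi * l / 2 ^ j)) * F (2 * Real.pi * m / 2 ^ j) else 0

lemma sum_conj_levelCoef_mul (F : ℝ → ℂ) (j : ℕ) (l m : ℤ) :
    ∑ k ∈ Finset.range (2 ^ j), (starRingEnd ℂ) (levelCoef F j k l) * levelCoef F j k m =
      frameKernel F j l m := by
  have h1 : ∀ k : ℕ, (starRingEnd ℂ) (levelCoef F j k l) * levelCoef F j k m =
      ((2 : ℂ) ^ j)⁻¹ * ((starRingEnd ℂ) (F (2 * Real.pi * l / 2 ^ j)) *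
        F (2 * Real.pi * m / 2 ^ j)) * char (l - m) (k / 2 ^ j) := fun k => by
    have hp : (((2 : ℝ) ^ (-(j : ℝ) / 2) : ℝ) : ℂ) * ((2 : ℝ) ^ (-(j : ℝ) / 2) : ℝ)
        = ((2 : ℂ) ^ j)⁻¹ := by
      rw [← Complex.ofReal_mul, ← Real.rpow_add (by norm_num), add_halves,
        Real.rpow_neg (by norm_num), Real.rpow_natCast]
      push_cast; rfl
    rw [levelCoef, levelCoef, map_mul, map_mul, conj_char, neg_neg, Complex.conj_ofReal,
      sub_eq_add_neg, char_add, ← hp]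
    ring
  simp_rw [h1, ← Finset.mul_sum, sum_char_dyadic, frameKernel]
  split_ifs
  · have h2 : (2 : ℂ) ^ j ≠ 0 := pow_ne_zero _ two_ne_zero
    field_simp
  · simp

/-- The squared coefficients of `f` at one scale add up to a quadratic form in the Fourier
coefficients of `f`. -/
lemma IsBandLimited.sum_coef_sq {F : ℝ → ℂ} (hF : IsBandLimited F) {f : ℝ → ℝ} (hf : IsL2 f)
    (j : ℕ) {S : Finset ℤ} (hS : band j ⊆ S) :
    ((∑ k ∈ Finset.range (2 ^ j), coef f (periodize (ofFourier F) j k) ^ 2 : ℝ) : ℂ) =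
      ∑ l ∈ S, ∑ m ∈ S, frameKernel F j l m * (fCoef f l * (starRingEnd ℂ) (fCoef f m)) := by
  have h1 : ∀ k : ℕ, ((coef f (periodize (ofFourier F) j k) ^ 2 : ℝ) : ℂ) =
      ∑ l ∈ S, ∑ m ∈ S, ((starRingEnd ℂ) (levelCoef F j k l) * levelCoef F j k m) *
        (fCoef f l * (starRingEnd ℂ) (fCoef f m)) := fun k => by
    have hc : (coef f (periodize (ofFourier F) j k) : ℂ) =
        ∑ l ∈ S, (starRingEnd ℂ) (levelCoef F j k l) * fCoef f l := by
      rw [(hF.isTrigPoly j k).coef_eq hf]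
      simp_rw [hF.fCoef_periodize]
      exact Finset.sum_subset hS fun l _ hl => by rw [hF.levelCoef_eq_zero hl]; simp
    rw [pow_two, Complex.ofReal_mul]
    nth_rw 2 [← Complex.conj_ofReal]
    rw [hc, map_sum, Finset.sum_mul_sum]
    refine Finset.sum_congr rfl fun l _ => Finset.sum_congr rfl fun m _ => ?_
    rw [map_mul, Complex.conj_conj]; ring
  push_cast at h1 ⊢
  simp_rw [h1]
  rw [Finset.sum_comm]
  refine Finset.sum_congr rfl fun l _ => ?_
  rw [Finset.sum_comm]
  refine Finset.sum_congr rfl fun m _ => ?_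
  rw [← Finset.sum_mul, sum_conj_levelCoef_mul]

namespace MeyerFilter

variable (h : MeyerFilter)

/-- The kernels of the scaling functions and wavelets of scale `j` add up to the kernel of the
scaling functions of scale `j + 1`. This is where the quadrature identity enters. -/
lemma frameKernel_add (j : ℕ) (l m : ℤ) :
    frameKernel (fun ω => (h.phiHat ω : ℂ)) j l m + frameKernel h.psiHat j l m =
      frameKernel (fun ω => (h.phiHat ω : ℂ)) (j + 1) l m := by
  simp only [frameKernel]
  by_cases hd : (2 ^ j : ℤ) ∣ l - m
  swap
  · have : ¬ (2 ^ (j + 1) : ℤ) ∣ l - m := fun h' => hd ((pow_dvd_pow 2 (Nat.le_succ j)).trans h')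
    simp [hd, this]
  obtain ⟨q, hq⟩ := hd
  have hdbl : ∀ l : ℤ, 2 * Real.pi * l / 2 ^ j = 2 * (2 * Real.pi * l / 2 ^ (j + 1)) := fun l => by
    rw [pow_succ]; field_simp
  rw [hdbl, hdbl, if_pos ⟨q, hq⟩, if_pos ⟨q, hq⟩]
  set a : ℝ := 2 * Real.pi * l / 2 ^ (j + 1)
  set b : ℝ := 2 * Real.pi * m / 2 ^ (j + 1)
  have hab : a = b + q * Real.pi := by
    have : (l : ℝ) = m + 2 ^ j * q := by
      have : l = m + 2 ^ j * q := by linarith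
      exact_mod_cast this
    simp only [a, b, this, pow_succ]
    field_simp
  have hs : (Real.sqrt 2 : ℂ) * Real.sqrt 2 = 2 := by
    rw [← Complex.ofReal_mul, Real.mul_self_sqrt (by norm_num)]; norm_num
  have hs0 : (Real.sqrt 2 : ℂ) ≠ 0 := fun h0 => by simp [h0] at hs
  have hexp : (starRingEnd ℂ) (Complex.exp (-(Complex.I * a))) * Complex.exp (-(Complex.I * b))
      = Complex.exp (q * (Real.pi * Complex.I)) := by
    rw [← Complex.exp_conj, ← Complex.exp_add, hab]
    congr 1
    simp only [map_neg, map_mul, Complex.conj_ofReal, Complex.conj_I]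
    push_cast; ring
  have hL : (starRingEnd ℂ) (h.phiHat (2 * a) : ℂ) * (h.phiHat (2 * b) : ℂ) +
      (starRingEnd ℂ) (h.psiHat (2 * a)) * h.psiHat (2 * b) =
      ((h.phiHat a : ℂ) * h.phiHat b) / 2 * (h.toFun a * h.toFun b +
        Complex.exp (q * (Real.pi * Complex.I)) *
          (h.toFun (a + Real.pi) * h.toFun (b + Real.pi))) := by
    rw [h.phiHat_two_mul, h.phiHat_two_mul, h.psiHat_two_mul, h.psiHat_two_mul, ← hexp, map_mul,
      Complex.conj_ofReal, Complex.conj_ofReal, ← hs]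
    push_cast
    field_simp
  rw [hL]
  rcases Int.even_or_odd' q with ⟨p, hp | hp⟩
  · have hdvd : (2 ^ (j + 1) : ℤ) ∣ l - m := ⟨p, by rw [hq, hp]; ring⟩
    have e1 : h.toFun a = h.toFun b := by
      rw [hab, hp, ← h.periodic.int_mul p b]; congr 1; push_cast; ring
    have e2 : h.toFun (a + Real.pi) = h.toFun (b + Real.pi) := by
      rw [hab, hp, ← h.periodic.int_mul p (b + Real.pi)]; congr 1; push_cast; ring
    have e3 : Complex.exp (q * (Real.pi * Complex.I)) = 1 := by
      rw [Complex.exp_eq_one_iff]; exact ⟨p, by rw [hp]; push_cast; ring⟩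
    rw [if_pos hdvd, e1, e2, e3, Complex.conj_ofReal]
    have := h.quadrature b
    have hc : (h.toFun b : ℂ) * h.toFun b + 1 * (h.toFun (b + Real.pi) * h.toFun (b + Real.pi))
        = 2 := by
      rw [one_mul]; norm_cast; rw [← this]; ring
    rw [hc]; ring
  · have hdvd : ¬ (2 ^ (j + 1) : ℤ) ∣ l - m := by
      rintro ⟨r, hr⟩
      have h2 : (2 ^ j : ℤ) * q = 2 ^ j * (2 * r) := by rw [← hq, hr]; ring
      have := mul_left_cancel₀ (by positivity) h2
      omega
    have e1 : h.toFun a = h.toFun (b + Real.pi) := by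
      rw [hab, hp, ← h.periodic.int_mul p (b + Real.pi)]; congr 1; push_cast; ring
    have e2 : h.toFun (a + Real.pi) = h.toFun b := by
      rw [hab, hp, ← h.periodic.int_mul (p + 1) b]; congr 1; push_cast; ring
    have e3 : Complex.exp (q * (Real.pi * Complex.I)) = -1 := by
      rw [hp, show (((2 * p + 1 : ℤ) : ℂ)) * (Real.pi * Complex.I)
        = p * (2 * Real.pi * Complex.I) + Real.pi * Complex.I by push_cast; ring, Complex.exp_add,
        Complex.exp_int_mul_two_pi_mul_I, Complex.exp_pi_mul_I, one_mul]
    rw [if_neg hdvd, e1, e2, e3]; ring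

/-- Energy of `f` in the approximation space of scale `j`. -/
noncomputable def scalingEnergy (f : ℝ → ℝ) (j : ℕ) : ℝ :=
  ∑ k ∈ Finset.range (2 ^ j), coef f (h.phi j k) ^ 2

/-- Energy of `f` in the detail space of scale `j`. -/
noncomputable def waveletEnergy (f : ℝ → ℝ) (j : ℕ) : ℝ :=
  ∑ k ∈ Finset.range (2 ^ j), coef f (h.psi j k) ^ 2

lemma band_subset_succ (j : ℕ) : band j ⊆ band (j + 1) := by
  have : (2 : ℤ) ^ j ≤ 2 ^ (j + 1) := pow_le_pow_right₀ (by norm_num) (Nat.le_succ j)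
  exact Finset.Icc_subset_Icc (by linarith) (by linarith)

lemma scalingEnergy_succ {f : ℝ → ℝ} (hf : IsL2 f) (j : ℕ) :
    h.scalingEnergy f (j + 1) = h.scalingEnergy f j + h.waveletEnergy f j := by
  have h1 := h.isBandLimited_phiHat.sum_coef_sq hf j (band_subset_succ j)
  have h2 := h.isBandLimited_psiHat.sum_coef_sq hf j (band_subset_succ j)
  have h3 := h.isBandLimited_phiHat.sum_coef_sq hf (j + 1) subset_rfl
  have : ((h.scalingEnergy f (j + 1) : ℝ) : ℂ) =
      ((h.scalingEnergy f j + h.waveletEnergy f j : ℝ) : ℂ) := by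
    rw [Complex.ofReal_add]
    refine h3.trans (Eq.trans ?_ (congrArg₂ (· + ·) h1 h2).symm)
    simp_rw [← Finset.sum_add_distrib, ← add_mul, h.frameKernel_add]
  exact_mod_cast this

/-- Frequencies at scale `j` where the transform of the scaling function equals one. -/
noncomputable def core (j : ℕ) : Finset ℤ := Finset.Icc (-(2 ^ j / 3)) (2 ^ j / 3)

lemma mem_core {j : ℕ} {l : ℤ} : l ∈ core j ↔ 3 * |l| ≤ 2 ^ j := by
  rw [core, Finset.mem_Icc, ← abs_le, Int.le_ediv_iff_mul_le (by norm_num), mul_comm]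

lemma tendsto_core : Tendsto core atTop atTop := by
  refine tendsto_atTop_finset_of_monotone (fun i j hij l hl => ?_) fun l => ?_
  · rw [mem_core] at hl ⊢
    exact hl.trans (pow_le_pow_right₀ (by norm_num) hij)
  · refine ⟨(3 * |l|).toNat, mem_core.2 ?_⟩
    have h1 : (3 * |l|).toNat < 2 ^ (3 * |l|).toNat := Nat.lt_two_pow_self
    have h2 : 3 * |l| = ((3 * |l|).toNat : ℤ) := (Int.toNat_of_nonneg (by positivity)).symm
    rw [h2]
    exact_mod_cast h1.le

lemma frameKernel_core {j : ℕ} {l : ℤ} (hl : l ∈ core j) (m : ℤ) :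
    frameKernel (fun ω => (h.phiHat ω : ℂ)) j l m = if m = l then 1 else 0 := by
  have hj : (0 : ℝ) < 2 ^ j := by positivity
  have habs : ∀ l : ℤ, |2 * Real.pi * l / 2 ^ j| = 2 * Real.pi * |(l : ℝ)| / 2 ^ j := fun l => by
    rw [abs_div, abs_mul, abs_of_pos Real.two_pi_pos, abs_of_pos hj]
  rw [mem_core] at hl
  have h1 : h.phiHat (2 * Real.pi * l / 2 ^ j) = 1 := by
    apply h.phiHat_eq_one
    have : (3 : ℝ) * |(l : ℝ)| ≤ 2 ^ j := by exact_mod_cast hl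
    rw [habs, div_le_iff₀ hj]
    nlinarith [Real.pi_pos]
  simp only [frameKernel]
  split_ifs with hd hm hm
  · subst hm; simp [h1]
  · have h0 : h.phiHat (2 * Real.pi * m / 2 ^ j) = 0 := by
      apply h.phiHat_eq_zero
      have h2 : (2 : ℤ) ^ j ≤ |l - m| :=
        Int.le_of_dvd (abs_pos.2 (sub_ne_zero.2 (Ne.symm hm))) ((dvd_abs _ _).2 hd)
      have h3 : 2 * 2 ^ j ≤ 3 * |m| := by
        have := abs_sub l m
        linarith
      have : (2 : ℝ) * 2 ^ j ≤ 3 * |(m : ℝ)| := by exact_mod_cast h3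
      rw [habs, le_div_iff₀ hj]
      nlinarith [Real.pi_pos]
    simp [h0]
  · exact absurd (by simp [hm]) hd
  · rfl

lemma frameKernel_conj (F : ℝ → ℂ) (j : ℕ) (l m : ℤ) :
    frameKernel F j m l = (starRingEnd ℂ) (frameKernel F j l m) := by
  have : ((2 ^ j : ℤ) ∣ m - l) ↔ (2 ^ j : ℤ) ∣ l - m := dvd_sub_comm
  simp only [frameKernel, this]
  split_ifs
  · rw [map_mul, Complex.conj_conj, mul_comm]
  · simp

lemma norm_frameKernel_le {F : ℝ → ℂ} (hF : IsBandLimited F) (j : ℕ) (l m : ℤ) :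
    ‖frameKernel F j l m‖ ≤ if (2 ^ j : ℤ) ∣ l - m then 1 else 0 := by
  rw [frameKernel]
  split_ifs
  · rw [norm_mul, RCLike.norm_conj]
    exact mul_le_one₀ (hF.norm_le_one _) (norm_nonneg _) (hF.norm_le_one _)
  · simp

/-- A residue class modulo `2^j` meets the band of scale `j` in at most five points. -/
lemma card_band_filter_le (j : ℕ) (l : ℤ) :
    ((band j).filter fun m => (2 ^ j : ℤ) ∣ l - m).card ≤ 5 := by
  have hp : (0 : ℤ) < 2 ^ j := by positivity
  have : (Finset.Icc (-2 : ℤ) 2).card = 5 := by simp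
  rw [← this]
  refine Finset.card_le_card_of_injOn (fun m => m / 2 ^ j) (fun m hm => ?_) fun m hm m' hm' e => ?_
  · simp only [Finset.coe_filter, Set.mem_ofPred_eq, band, Finset.mem_Icc] at hm
    simp only [Finset.coe_Icc, Set.mem_Icc]
    constructor
    · rw [Int.le_ediv_iff_mul_le hp]; linarith
    · exact (Int.ediv_le_ediv hp hm.1.2).trans (by rw [Int.mul_ediv_cancel _ hp.ne'])
  · simp only [Finset.coe_filter, Set.mem_ofPred_eq] at hm hm'
    have h1 : (2 ^ j : ℤ) ∣ m - m' := by
      have := dvd_sub hm'.2 hm.2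
      rwa [sub_sub_sub_cancel_left] at this
    have h3 : m % 2 ^ j = m' % 2 ^ j :=
      Int.emod_eq_emod_iff_emod_sub_eq_zero.2 (Int.emod_eq_zero_of_dvd h1)
    rw [← Int.mul_ediv_add_emod m (2 ^ j), ← Int.mul_ediv_add_emod m' (2 ^ j), h3]
    simp only at e
    rw [e]

/-- The energy in the approximation space differs from the energy of the low frequencies by at most
a multiple of the energy of the high ones. -/
lemma abs_scalingEnergy_sub_le {f : ℝ → ℝ} (hf : IsL2 f) (j : ℕ) :
    |h.scalingEnergy f j - ∑ l ∈ core j, ‖fCoef f l‖ ^ 2| ≤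
      5 * ((∫ x in (0 : ℝ)..1, f x ^ 2) - ∑ l ∈ core j, ‖fCoef f l‖ ^ 2) := by
  set a : ℤ → ℝ := fun l => ‖fCoef f l‖ ^ 2 with ha
  set K := frameKernel (fun ω => (h.phiHat ω : ℂ)) j with hK
  set T := band j \ core j with hT
  have hsub : core j ⊆ band j := by
    have hp : (0 : ℤ) < 2 ^ j := by positivity
    have : (2 ^ j / 3 : ℤ) ≤ 2 ^ j := Int.ediv_le_self _ hp.le
    exact Finset.Icc_subset_Icc (by linarith) (by linarith)
  have hE : (h.scalingEnergy f j : ℂ) =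
      ∑ l ∈ band j, ∑ m ∈ band j, K l m * (fCoef f l * (starRingEnd ℂ) (fCoef f m)) :=
    h.isBandLimited_phiHat.sum_coef_sq hf j subset_rfl
  have hcore : ∑ l ∈ core j, ∑ m ∈ band j, K l m * (fCoef f l * (starRingEnd ℂ) (fCoef f m))
      = ((∑ l ∈ core j, a l : ℝ) : ℂ) := by
    push_cast
    refine Finset.sum_congr rfl fun l hl => ?_
    simp_rw [hK, h.frameKernel_core hl]
    simp [hsub hl, ha, Complex.mul_conj']
  have hcross : ∀ l ∈ T, ∑ m ∈ core j, K l m * (fCoef f l * (starRingEnd ℂ) (fCoef f m)) = 0 := by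
    intro l hl
    refine Finset.sum_eq_zero fun m hm => ?_
    have hne : l ≠ m := fun e => (Finset.mem_sdiff.1 hl).2 (e ▸ hm)
    rw [hK, frameKernel_conj, h.frameKernel_core hm, if_neg hne]; simp
  have hdiff : ((h.scalingEnergy f j - ∑ l ∈ core j, a l : ℝ) : ℂ) =
      ∑ l ∈ T, ∑ m ∈ T, K l m * (fCoef f l * (starRingEnd ℂ) (fCoef f m)) := by
    rw [Complex.ofReal_sub, hE, ← Finset.sum_sdiff hsub, hcore, add_sub_cancel_right]
    refine Finset.sum_congr rfl fun l hl => ?_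
    rw [← Finset.sum_sdiff hsub, hcross l hl, add_zero]
  have htail : ∑ l ∈ T, a l ≤ (∫ x in (0 : ℝ)..1, f x ^ 2) - ∑ l ∈ core j, a l := by
    rw [le_sub_iff_add_le, hT, Finset.sum_sdiff hsub]
    exact sum_le_hasSum _ (fun l _ => by positivity) hf.hasSum_sq_fCoef
  rw [← Real.norm_eq_abs, ← Complex.norm_real, hdiff]
  refine le_trans ?_ (mul_le_mul_of_nonneg_left htail (by norm_num))
  let χ : ℤ → ℤ → ℝ := fun l m => if (2 ^ j : ℤ) ∣ l - m then 1 else 0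
  have hχ0 : ∀ l m, 0 ≤ χ l m := fun l m => by simp only [χ]; split_ifs <;> norm_num
  have hχs : ∀ l m, χ l m = χ m l := fun l m => by
    simp only [χ]
    have : ((2 ^ j : ℤ) ∣ m - l) ↔ (2 ^ j : ℤ) ∣ l - m := dvd_sub_comm
    simp only [this]
  calc ‖∑ l ∈ T, ∑ m ∈ T, K l m * (fCoef f l * (starRingEnd ℂ) (fCoef f m))‖
      ≤ ∑ l ∈ T, ∑ m ∈ T, (χ l m * a l / 2 + χ m l * a m / 2) := by
        refine (norm_sum_le _ _).trans (Finset.sum_le_sum fun l _ => (norm_sum_le _ _).trans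
          (Finset.sum_le_sum fun m _ => ?_))
        rw [norm_mul, norm_mul, RCLike.norm_conj, hχs m l, ← add_div, ← mul_add, mul_div_assoc]
        refine mul_le_mul (norm_frameKernel_le h.isBandLimited_phiHat j l m) ?_ (by positivity)
          (hχ0 l m)
        simp only [ha]
        linarith [two_mul_le_add_sq ‖fCoef f l‖ ‖fCoef f m‖]
    _ = ∑ l ∈ T, ∑ m ∈ T, χ l m * a l := by
        simp_rw [Finset.sum_add_distrib]
        rw [Finset.sum_comm (f := fun l m => χ m l * a m / 2)]
        simp_rw [← Finset.sum_add_distrib, add_halves]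
    _ ≤ ∑ l ∈ T, 5 * a l := by
        refine Finset.sum_le_sum fun l _ => ?_
        rw [← Finset.sum_mul]
        refine mul_le_mul_of_nonneg_right ?_ (by simp only [ha]; positivity)
        simp only [χ]
        rw [Finset.sum_ite, Finset.sum_const_zero, add_zero, Finset.sum_const, nsmul_eq_mul,
          mul_one]
        have h1 : (T.filter fun m => (2 ^ j : ℤ) ∣ l - m).card ≤ 5 :=
          (Finset.card_le_card (Finset.filter_subset_filter _ Finset.sdiff_subset)).trans
            (card_band_filter_le j l)
        exact_mod_cast h1
    _ = 5 * ∑ l ∈ T, a l := by rw [Finset.mul_sum]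

lemma tendsto_scalingEnergy {f : ℝ → ℝ} (hf : IsL2 f) :
    Tendsto (h.scalingEnergy f) atTop (𝓝 (∫ x in (0 : ℝ)..1, f x ^ 2)) := by
  have h1 : Tendsto (fun j => ∑ l ∈ core j, ‖fCoef f l‖ ^ 2) atTop
      (𝓝 (∫ x in (0 : ℝ)..1, f x ^ 2)) :=
    Tendsto.comp (f := core) hf.hasSum_sq_fCoef tendsto_core
  have h2 : Tendsto (fun j => 5 * ((∫ x in (0 : ℝ)..1, f x ^ 2) -
      ∑ l ∈ core j, ‖fCoef f l‖ ^ 2)) atTop (𝓝 0) := by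
    have := (h1.const_sub (∫ x in (0 : ℝ)..1, f x ^ 2)).const_mul 5
    rwa [sub_self, mul_zero] at this
  have h3 := squeeze_zero_norm (f := fun j => h.scalingEnergy f j -
    ∑ l ∈ core j, ‖fCoef f l‖ ^ 2) (fun j => h.abs_scalingEnergy_sub_le hf j) h2
  simpa using h3.add h1

lemma waveletEnergy_nonneg (f : ℝ → ℝ) (j : ℕ) : 0 ≤ h.waveletEnergy f j :=
  Finset.sum_nonneg fun _ _ => sq_nonneg _

lemma scalingEnergy_add {f : ℝ → ℝ} (hf : IsL2 f) (j m : ℕ) :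
    h.scalingEnergy f j + ∑ i ∈ Finset.range m, h.waveletEnergy f (j + i) =
      h.scalingEnergy f (j + m) := by
  induction m with
  | zero => simp
  | succ m ih => rw [Finset.sum_range_succ, ← add_assoc, ih, ← add_assoc, h.scalingEnergy_succ hf]

/-- Completeness of the system from scale `j` on: Parseval's identity. -/
lemma hasSum_waveletEnergy {f : ℝ → ℝ} (hf : IsL2 f) (j : ℕ) :
    HasSum (fun i => h.waveletEnergy f (j + i))
      ((∫ x in (0 : ℝ)..1, f x ^ 2) - h.scalingEnergy f j) := by
  rw [hasSum_iff_tendsto_nat_of_nonneg fun _ => h.waveletEnergy_nonneg f _]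
  have h1 : ∀ m, ∑ i ∈ Finset.range m, h.waveletEnergy f (j + i) =
      h.scalingEnergy f (m + j) - h.scalingEnergy f j := fun m => by
    rw [add_comm m j, ← h.scalingEnergy_add hf j m]; ring
  simp_rw [h1]
  exact ((tendsto_add_atTop_iff_nat j).2 (h.tendsto_scalingEnergy hf)).sub_const _

lemma scalingEnergy_le {f : ℝ → ℝ} (hf : IsL2 f) (j : ℕ) :
    h.scalingEnergy f j ≤ ∫ x in (0 : ℝ)..1, f x ^ 2 :=
  sub_nonneg.1 ((h.hasSum_waveletEnergy hf j).nonneg fun _ => h.waveletEnergy_nonneg f _)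

lemma scalingEnergy_add_Icc {f : ℝ → ℝ} (hf : IsL2 f) {j₀ j₁ : ℕ} (hj : j₀ ≤ j₁) :
    h.scalingEnergy f j₀ + ∑ j ∈ Finset.Icc j₀ j₁, h.waveletEnergy f j =
      h.scalingEnergy f (j₁ + 1) := by
  have h1 := h.scalingEnergy_add hf j₀ (j₁ + 1 - j₀)
  rw [Nat.add_sub_cancel' (by omega)] at h1
  rw [← h1, ← Finset.Ico_add_one_right_eq_Icc, Finset.sum_Ico_eq_sum_range]

end MeyerFilter

/-! ### Quadratic loss in terms of coefficients -/

/-- A Bessel family has a contractive synthesis operator. -/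
lemma integral_sum_mul_sq_le {ι : Type*} {s : Finset ι} {g : ι → ℝ → ℝ}
    (hg : ∀ i, Continuous (g i))
    (hB : ∀ F, IsL2 F → ∑ i ∈ s, coef F (g i) ^ 2 ≤ ∫ x in (0 : ℝ)..1, F x ^ 2) (a : ι → ℝ) :
    ∫ x in (0 : ℝ)..1, (∑ i ∈ s, a i * g i x) ^ 2 ≤ ∑ i ∈ s, a i ^ 2 := by
  set F : ℝ → ℝ := fun x => ∑ i ∈ s, a i * g i x with hF
  have hFc : Continuous F := continuous_finsetSum _ fun i _ => continuous_const.mul (hg i)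
  have h1 : ∫ x in (0 : ℝ)..1, F x ^ 2 = ∑ i ∈ s, a i * coef F (g i) := by
    have : ∀ x, F x ^ 2 = ∑ i ∈ s, a i * (F x * g i x) := fun x => by
      rw [pow_two]; nth_rw 2 [hF]; rw [Finset.mul_sum]
      exact Finset.sum_congr rfl fun i _ => by ring
    simp_rw [this]
    rw [intervalIntegral.integral_finsetSum fun i _ =>
      IntervalIntegrable.const_mul (f := fun x => F x * g i x)
        ((hFc.mul (hg i)).intervalIntegrable _ _) (a i)]
    simp_rw [intervalIntegral.integral_const_mul, coef]
  have h2 := Finset.sum_mul_sq_le_sq_mul_sq s a fun i => coef F (g i)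
  rw [← h1] at h2
  have h3 := hB F (isL2_of_continuous hFc)
  have h4 : 0 ≤ ∑ i ∈ s, a i ^ 2 := Finset.sum_nonneg fun _ _ => sq_nonneg _
  have h5 : 0 ≤ ∫ x in (0 : ℝ)..1, F x ^ 2 :=
    intervalIntegral.integral_nonneg zero_le_one fun _ _ => sq_nonneg _
  by_contra! hlt
  nlinarith [mul_le_mul_of_nonneg_left h3 h4]

/-- Loss of a linear combination of a Bessel family against the errors in its coefficients. -/
lemma integral_sum_sub_sq_le {ι : Type*} {s : Finset ι} {g : ι → ℝ → ℝ}
    (hg : ∀ i, Continuous (g i))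
    (hB : ∀ F, IsL2 F → ∑ i ∈ s, coef F (g i) ^ 2 ≤ ∫ x in (0 : ℝ)..1, F x ^ 2) (a : ι → ℝ)
    {f : ℝ → ℝ} (hf : IsL2 f) :
    ∫ x in (0 : ℝ)..1, ((∑ i ∈ s, a i * g i x) - f x) ^ 2 ≤
      2 * ∑ i ∈ s, (a i - coef f (g i)) ^ 2 +
      2 * ((∫ x in (0 : ℝ)..1, f x ^ 2) - ∑ i ∈ s, coef f (g i) ^ 2) := by
  have hc : ∀ b : ι → ℝ, Continuous fun x => ∑ i ∈ s, b i * g i x := fun b =>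
    continuous_finsetSum _ fun i _ => continuous_const.mul (hg i)
  have hL : ∀ b : ι → ℝ, IsL2 fun x => ∑ i ∈ s, b i * g i x := fun b => isL2_of_continuous (hc b)
  have hi : ∀ {u v : ℝ → ℝ}, IsL2 u → IsL2 v →
      IntervalIntegrable (fun x => u x * v x) volume 0 1 :=
    fun hu hv => hu.intervalIntegrable_mul hv
  have hi2 : ∀ {u : ℝ → ℝ}, IsL2 u → IntervalIntegrable (fun x => u x ^ 2) volume 0 1 :=
    fun hu => by simpa only [pow_two] using hi hu hu
  -- the comparison goes through the projection `P` of `f`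
  set P : ℝ → ℝ := fun x => ∑ i ∈ s, coef f (g i) * g i x
  set D : ℝ → ℝ := fun x => ∑ i ∈ s, (a i - coef f (g i)) * g i x
  have hPL : IsL2 P := hL _
  have hDL : IsL2 D := hL _
  have hPf : IsL2 fun x => P x - f x := hPL.sub hf
  have h1 : ∫ x in (0 : ℝ)..1, ((∑ i ∈ s, a i * g i x) - f x) ^ 2 ≤
      ∫ x in (0 : ℝ)..1, (2 * D x ^ 2 + 2 * (P x - f x) ^ 2) := by
    refine intervalIntegral.integral_mono_on zero_le_one (hi2 ((hL a).sub hf))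
      (((hi2 hDL).const_mul 2).add ((hi2 hPf).const_mul 2)) fun x _ => ?_
    have : (∑ i ∈ s, a i * g i x) = D x + P x := by
      simp only [D, P, ← Finset.sum_add_distrib]
      exact Finset.sum_congr rfl fun i _ => by ring
    rw [this]
    nlinarith [sq_nonneg (D x - (P x - f x))]
  have h2 : ∫ x in (0 : ℝ)..1, (P x - f x) ^ 2 = (∫ x in (0 : ℝ)..1, P x ^ 2) -
      2 * (∫ x in (0 : ℝ)..1, f x * P x) + ∫ x in (0 : ℝ)..1, f x ^ 2 := by
    have : ∀ x, (P x - f x) ^ 2 = P x ^ 2 - 2 * (f x * P x) + f x ^ 2 := fun x => by ring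
    simp_rw [this]
    rw [intervalIntegral.integral_add ((hi2 hPL).sub ((hi hf hPL).const_mul 2)) (hi2 hf),
      intervalIntegral.integral_sub (hi2 hPL) ((hi hf hPL).const_mul 2),
      intervalIntegral.integral_const_mul]
  have h3 : ∫ x in (0 : ℝ)..1, f x * P x = ∑ i ∈ s, coef f (g i) ^ 2 := by
    have : ∀ x, f x * P x = ∑ i ∈ s, coef f (g i) * (f x * g i x) := fun x => by
      simp only [P, Finset.mul_sum]
      exact Finset.sum_congr rfl fun i _ => by ring
    simp_rw [this]
    rw [intervalIntegral.integral_finsetSum fun i _ =>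
      (hi hf (isL2_of_continuous (hg i))).const_mul (coef f (g i))]
    simp_rw [intervalIntegral.integral_const_mul, pow_two, coef]
  have h4 : ∫ x in (0 : ℝ)..1, P x ^ 2 ≤ _ :=
    integral_sum_mul_sq_le hg hB fun i => coef f (g i)
  have h5 : ∫ x in (0 : ℝ)..1, D x ^ 2 ≤ _ :=
    integral_sum_mul_sq_le hg hB fun i => a i - coef f (g i)
  rw [intervalIntegral.integral_add ((hi2 hDL).const_mul 2) ((hi2 hPf).const_mul 2),
    intervalIntegral.integral_const_mul, intervalIntegral.integral_const_mul] at h1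
  linarith

lemma eLpNorm_two_sq {u : ℝ → ℝ} (hu : IsL2 u) :
    eLpNorm u 2 (volume.restrict (Set.Icc 0 1)) ^ 2 =
      ENNReal.ofReal (∫ x in (0 : ℝ)..1, u x ^ 2) := by
  rw [hu.eLpNorm_eq_integral_rpow_norm (by norm_num) (by norm_num),
    ← ENNReal.ofReal_pow (by positivity), intervalIntegral.integral_of_le zero_le_one,
    ← integral_Icc_eq_integral_Ioc]
  congr 1
  have h0 : 0 ≤ ∫ x in Set.Icc (0 : ℝ) 1, u x ^ 2 := integral_nonneg fun _ => sq_nonneg _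
  simp only [ENNReal.toReal_ofNat, Real.rpow_two, Real.norm_eq_abs, sq_abs]
  rw [← Real.rpow_natCast, ← Real.rpow_mul h0]
  norm_num

open Classical in
/-- Hard-thresholded empirical wavelet coefficient. -/
noncomputable def thresholded {n : ℕ} (X : Fin n → ℝ) (δ : ℝ) (g : ℝ → ℝ) : ℝ :=
  if threshold X δ g ≤ |empCoef X g| then empCoef X g else 0

namespace MeyerFilter

variable (h : MeyerFilter)

lemma isTrigPoly_phi (j k : ℕ) : IsTrigPoly (h.phi j k) (band j) :=
  h.isBandLimited_phiHat.isTrigPoly j k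

lemma isTrigPoly_psi (j k : ℕ) : IsTrigPoly (h.psi j k) (band j) :=
  h.isBandLimited_psiHat.isTrigPoly j k

lemma waveletEnergy_le {f : ℝ → ℝ} (hf : IsL2 f) (j : ℕ) :
    h.waveletEnergy f j ≤ ∫ x in (0 : ℝ)..1, f x ^ 2 := by
  have h1 := h.scalingEnergy_succ hf j
  have h2 := h.scalingEnergy_le hf (j + 1)
  have h3 : 0 ≤ h.scalingEnergy f j := Finset.sum_nonneg fun _ _ => sq_nonneg _
  linarith

/-- Elements of a Bessel system have norm at most one. -/
lemma integral_psi_sq_le {j k : ℕ} (hk : k < 2 ^ j) :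
    ∫ x in (0 : ℝ)..1, h.psi j k x ^ 2 ≤ 1 := by
  have h1 := h.waveletEnergy_le (isL2_of_continuous (h.isTrigPoly_psi j k).continuous) j
  have h2 : coef (h.psi j k) (h.psi j k) ^ 2 ≤ h.waveletEnergy (h.psi j k) j :=
    Finset.single_le_sum (f := fun k' => coef (h.psi j k) (h.psi j k') ^ 2)
      (fun _ _ => sq_nonneg _) (Finset.mem_range.2 hk)
  have h3 : coef (h.psi j k) (h.psi j k) = ∫ x in (0 : ℝ)..1, h.psi j k x ^ 2 := by
    simp_rw [coef, pow_two]
  rw [h3] at h2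
  have h4 : 0 ≤ ∫ x in (0 : ℝ)..1, h.psi j k x ^ 2 :=
    intervalIntegral.integral_nonneg zero_le_one fun _ _ => sq_nonneg _
  by_contra! hlt
  nlinarith

/-- The loss of the estimator is controlled by the errors of its coefficients and by the energy at
fine scales. -/
lemma eLpNorm_estimator_sub_le {f : ℝ → ℝ} (hf : IsL2 f) {n : ℕ} (X : Fin n → ℝ) (δ : ℝ)
    {j₀ j₁ : ℕ} (hj : j₀ ≤ j₁) :
    eLpNorm (fun x => estimator X h δ j₀ j₁ x - f x) 2 (volume.restrict (Set.Icc 0 1)) ^ 2 ≤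
      ENNReal.ofReal (
        2 * (∑ k ∈ Finset.range (2 ^ j₀), (empCoef X (h.phi j₀ k) - coef f (h.phi j₀ k)) ^ 2 +
          ∑ j ∈ Finset.Icc j₀ j₁, ∑ k ∈ Finset.range (2 ^ j),
            (thresholded X δ (h.psi j k) - coef f (h.psi j k)) ^ 2) +
        2 * ∑' i : ℕ, h.waveletEnergy f (j₁ + 1 + i)) := by
  let s : Finset (ℕ ⊕ (Σ _ : ℕ, ℕ)) := (Finset.range (2 ^ j₀)).disjSum
    ((Finset.Icc j₀ j₁).sigma fun j => Finset.range (2 ^ j))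
  let g : (ℕ ⊕ (Σ _ : ℕ, ℕ)) → ℝ → ℝ := Sum.elim (h.phi j₀) fun p => h.psi p.1 p.2
  let a : (ℕ ⊕ (Σ _ : ℕ, ℕ)) → ℝ := Sum.elim (fun k => empCoef X (h.phi j₀ k))
    fun p => thresholded X δ (h.psi p.1 p.2)
  have hg : ∀ i, Continuous (g i) := by
    rintro (k | p)
    · exact (h.isTrigPoly_phi j₀ k).continuous
    · exact (h.isTrigPoly_psi p.1 p.2).continuous
  have hsum : ∀ F, IsL2 F → ∑ i ∈ s, coef F (g i) ^ 2 = h.scalingEnergy F (j₁ + 1) := fun F hF => by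
    rw [← h.scalingEnergy_add_Icc hF hj, Finset.sum_disjSum, Finset.sum_sigma]; rfl
  have hB : ∀ F, IsL2 F → ∑ i ∈ s, coef F (g i) ^ 2 ≤ ∫ x in (0 : ℝ)..1, F x ^ 2 :=
    fun F hF => (hsum F hF).trans_le (h.scalingEnergy_le hF _)
  have hest : estimator X h δ j₀ j₁ = fun x => ∑ i ∈ s, a i * g i x := by
    ext x
    rw [estimator, Finset.sum_disjSum, Finset.sum_sigma]
    refine congrArg₂ _ rfl (Finset.sum_congr rfl fun j _ => Finset.sum_congr rfl fun k _ => ?_)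
    simp only [a, g, Sum.elim_inr, thresholded]
    split_ifs <;> simp
  have hest2 : IsL2 (estimator X h δ j₀ j₁) := by
    rw [hest]
    exact isL2_of_continuous (continuous_finsetSum _ fun i _ => continuous_const.mul (hg i))
  have hdiff : IsL2 fun x => estimator X h δ j₀ j₁ x - f x := hest2.sub hf
  rw [eLpNorm_two_sq hdiff, hest]
  refine ENNReal.ofReal_le_ofReal ((integral_sum_sub_sq_le hg hB a hf).trans (le_of_eq ?_))
  rw [hsum f hf, (h.hasSum_waveletEnergy hf (j₁ + 1)).tsum_eq, Finset.sum_disjSum,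
    Finset.sum_sigma]
  rfl

end MeyerFilter

/-! ### Exponential inequalities for sums of bounded functions of the sample -/

/-- Comparison of the exponential series with a geometric one: the estimate behind Bernstein's
inequality. -/
lemma exp_le_bernstein {x b : ℝ} (hx : |x| ≤ b) (hb : b < 3) :
    Real.exp x ≤ 1 + x + x ^ 2 / (2 * (1 - b / 3)) := by
  have hb0 : 0 ≤ b := (abs_nonneg x).trans hx
  have h1 : HasSum (fun k : ℕ => x ^ (k + 2) / ((k + 2).factorial : ℝ)) (Real.exp x - (1 + x)) := by
    have := NormedSpace.expSeries_div_hasSum_exp x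
    rw [← hasSum_nat_add_iff' 2, ← Real.exp_eq_exp_ℝ] at this
    simpa [Finset.sum_range_succ] using this
  have h2 : HasSum (fun k : ℕ => x ^ 2 / 2 * (b / 3) ^ k) (x ^ 2 / 2 * (1 - b / 3)⁻¹) :=
    (hasSum_geometric_of_lt_one (by positivity) (by linarith)).mul_left _
  have hfac : ∀ k : ℕ, 2 * (3 : ℝ) ^ k ≤ (k + 2).factorial := fun k => by
    induction k with
    | zero => norm_num
    | succ k ih =>
      rw [show k + 1 + 2 = (k + 2) + 1 by ring, Nat.factorial_succ, pow_succ]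
      push_cast
      nlinarith [Nat.cast_nonneg (α := ℝ) k, Nat.cast_nonneg (α := ℝ) (k + 2).factorial]
  have h3 := hasSum_le (fun k => ?_) h1 h2
  · have : x ^ 2 / 2 * (1 - b / 3)⁻¹ = x ^ 2 / (2 * (1 - b / 3)) := by
      rw [← div_eq_mul_inv, div_div]
    linarith
  · have h4 : x ^ (k + 2) ≤ x ^ 2 * b ^ k := by
      refine (le_abs_self _).trans ?_
      rw [abs_pow, pow_add, mul_comm, sq_abs]
      exact mul_le_mul_of_nonneg_left (pow_le_pow_left₀ (abs_nonneg x) hx k) (sq_nonneg x)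
    calc x ^ (k + 2) / ((k + 2).factorial : ℝ) ≤ x ^ 2 * b ^ k / ((k + 2).factorial : ℝ) := by
          gcongr
      _ ≤ x ^ 2 * b ^ k / (2 * 3 ^ k) := by gcongr; exact hfac k
      _ = x ^ 2 / 2 * (b / 3) ^ k := by rw [div_pow]; field_simp

lemma exp_neg_le_quadratic {x : ℝ} (hx : 0 ≤ x) : Real.exp (-x) ≤ 1 - x + x ^ 2 / 2 := by
  have h1 := Real.quadratic_le_exp_of_nonneg hx
  rw [Real.exp_neg, inv_le_iff_one_le_mul₀ (Real.exp_pos x)]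
  have h2 : 0 < 1 - x + x ^ 2 / 2 := by nlinarith [sq_nonneg (x - 1)]
  nlinarith [mul_le_mul_of_nonneg_left h1 h2.le, sq_nonneg (x ^ 2)]

lemma integrable_of_abs_le {μ : Measure ℝ} [IsProbabilityMeasure μ] {g : ℝ → ℝ} {B : ℝ}
    (hg : Measurable g) (hB : ∀ x, |g x| ≤ B) : Integrable g μ :=
  Integrable.of_bound hg.aestronglyMeasurable B (Eventually.of_forall hB)

lemma abs_sum_comp_le {Ω : Type*} {n : ℕ} {X : Fin n → Ω → ℝ} {g : ℝ → ℝ} {B : ℝ}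
    (hB : ∀ x, |g x| ≤ B) (ω : Ω) :
    |∑ i, g (X i ω)| ≤ n * B := by
  refine (Finset.abs_sum_le_sum_abs _ _).trans ((Finset.sum_le_sum fun i _ => hB _).trans ?_)
  simp

section Sample

variable {Ω : Type*} [MeasurableSpace Ω] {P : Measure Ω} {n : ℕ} {X : Fin n → Ω → ℝ}
  {f : ℝ → ℝ} (hs : IsIIDSample P f X)

include hs in
lemma IsIIDSample.integral_comp {g : ℝ → ℝ} (hg : Measurable g) (i : Fin n) :
    ∫ ω, g (X i ω) ∂P = ∫ x, g x ∂(law f) := by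
  rw [← hs.map_eq i, integral_map (hs.measurable i).aemeasurable hg.aestronglyMeasurable]

include hs in
lemma IsIIDSample.measurable_sum {g : ℝ → ℝ} (hg : Measurable g) :
    Measurable fun ω => ∑ i, g (X i ω) :=
  Finset.measurable_sum _ fun i _ => hg.comp (hs.measurable i)

include hs in
/-- By independence, a bound on the exponential moment of one observation passes to the sum. -/
lemma IsIIDSample.mgf_sum_le {g : ℝ → ℝ} (hg : Measurable g) {t m q : ℝ}
    (hM : ∫ x, Real.exp (t * g x) ∂(law f) ≤ Real.exp (t * m + q)) :
    mgf (fun ω => ∑ i, g (X i ω)) P t ≤ Real.exp (t * (n * m) + n * q) := by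
  have h1 : (fun ω => ∑ i, g (X i ω)) = ∑ i, fun ω => g (X i ω) := by ext ω; simp
  have hind : iIndepFun (fun i => fun ω => g (X i ω)) P := hs.indep.comp (fun _ => g) fun _ => hg
  rw [h1, hind.mgf_sum (fun i => hg.comp (hs.measurable i))]
  have h2 : ∀ i, mgf (fun ω => g (X i ω)) P t ≤ Real.exp (t * m + q) := fun i => by
    rw [mgf, hs.integral_comp (g := fun x => Real.exp (t * g x)) (hg.const_mul t).exp]
    exact hM
  refine (Finset.prod_le_prod (fun i _ => mgf_nonneg) fun i _ => h2 i).trans (le_of_eq ?_)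
  rw [Finset.prod_const, Finset.card_univ, Fintype.card_fin, ← Real.exp_nat_mul]
  congr 1; ring

variable [IsProbabilityMeasure P]

include hs in
lemma IsIIDSample.isProbabilityMeasure (hn : 0 < n) : IsProbabilityMeasure (law f) := by
  rw [← hs.map_eq ⟨0, hn⟩]
  exact Measure.isProbabilityMeasure_map (hs.measurable _).aemeasurable

include hs in
lemma IsIIDSample.integrable_exp_sum {g : ℝ → ℝ} {B : ℝ} (hg : Measurable g)
    (hB : ∀ x, |g x| ≤ B) (t : ℝ) : Integrable (fun ω => Real.exp (t * ∑ i, g (X i ω))) P := by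
  refine Integrable.of_bound ((hs.measurable_sum hg).const_mul t).exp.aestronglyMeasurable
    (Real.exp (|t| * (n * B))) (Eventually.of_forall fun ω => ?_)
  rw [Real.norm_eq_abs, abs_of_pos (Real.exp_pos _), Real.exp_le_exp]
  refine (le_abs_self _).trans ?_
  rw [abs_mul]
  exact mul_le_mul_of_nonneg_left (abs_sum_comp_le hB ω) (abs_nonneg t)

include hs in
lemma IsIIDSample.chernoff {g : ℝ → ℝ} {B : ℝ} (hg : Measurable g) (hB : ∀ x, |g x| ≤ B)
    {t m q : ℝ} (ht : 0 ≤ t) (hM : ∫ x, Real.exp (t * g x) ∂(law f) ≤ Real.exp (t * m + q))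
    (a : ℝ) : P.real {ω | n * m + a ≤ ∑ i, g (X i ω)} ≤ Real.exp (-(t * a) + n * q) := by
  refine (measure_ge_le_exp_mul_mgf _ ht (hs.integrable_exp_sum hg hB t)).trans ?_
  refine (mul_le_mul_of_nonneg_left (hs.mgf_sum_le hg hM) (Real.exp_pos _).le).trans (le_of_eq ?_)
  rw [← Real.exp_add]; congr 1; ring

lemma integral_exp_mul_le {μ : Measure ℝ} [IsProbabilityMeasure μ] {g : ℝ → ℝ} {B : ℝ}
    (hg : Measurable g) (hB : ∀ x, |g x| ≤ B) {t : ℝ} (ht : 0 ≤ t) (htB : t * B < 3) :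
    ∫ x, Real.exp (t * g x) ∂μ ≤
      Real.exp (t * (∫ x, g x ∂μ) + t ^ 2 * (∫ x, g x ^ 2 ∂μ) / (2 * (1 - t * B / 3))) := by
  have hi1 := integrable_of_abs_le (μ := μ) hg hB
  have hi2 : Integrable (fun x => g x ^ 2) μ := integrable_of_abs_le (B := B ^ 2) (hg.pow_const 2)
    fun x => by rw [abs_pow]; exact pow_le_pow_left₀ (abs_nonneg _) (hB x) 2
  set c := 2 * (1 - t * B / 3)
  have hbd : ∀ x, Real.exp (t * g x) ≤ 1 + t * g x + t ^ 2 / c * g x ^ 2 := fun x => by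
    have h1 : |t * g x| ≤ t * B := by
      rw [abs_mul, abs_of_nonneg ht]; exact mul_le_mul_of_nonneg_left (hB x) ht
    refine (exp_le_bernstein h1 htB).trans (le_of_eq ?_)
    rw [mul_pow]; ring
  have hi3 : Integrable (fun x => 1 + t * g x) μ := (integrable_const 1).add (hi1.const_mul t)
  calc ∫ x, Real.exp (t * g x) ∂μ ≤ ∫ x, (1 + t * g x + t ^ 2 / c * g x ^ 2) ∂μ := by
        refine integral_mono_of_nonneg (Eventually.of_forall fun x => (Real.exp_pos _).le)
          (hi3.add (hi2.const_mul _)) (Eventually.of_forall hbd)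
    _ = 1 + t * (∫ x, g x ∂μ) + t ^ 2 / c * ∫ x, g x ^ 2 ∂μ := by
        rw [integral_add hi3 (hi2.const_mul _), integral_add (integrable_const 1) (hi1.const_mul t),
          integral_const_mul, integral_const_mul]
        simp
    _ = (t * (∫ x, g x ∂μ) + t ^ 2 * (∫ x, g x ^ 2 ∂μ) / c) + 1 := by ring
    _ ≤ _ := Real.add_one_le_exp _

/-- For nonnegative variables the lower tail needs no linear correction in the exponent. -/
lemma integral_exp_neg_sq_le {μ : Measure ℝ} [IsProbabilityMeasure μ] {g : ℝ → ℝ} {B : ℝ}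
    (hg : Measurable g) (hB : ∀ x, |g x| ≤ B) {t : ℝ} (ht : 0 ≤ t) :
    ∫ x, Real.exp (t * -g x ^ 2) ∂μ ≤
      Real.exp (t * -(∫ x, g x ^ 2 ∂μ) + t ^ 2 * B ^ 2 * (∫ x, g x ^ 2 ∂μ) / 2) := by
  have hsq : ∀ x, g x ^ 2 ≤ B ^ 2 := fun x => by
    rw [← sq_abs]; exact pow_le_pow_left₀ (abs_nonneg _) (hB x) 2
  have hi2 : Integrable (fun x => g x ^ 2) μ := integrable_of_abs_le (B := B ^ 2) (hg.pow_const 2)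
    fun x => by rw [abs_of_nonneg (sq_nonneg _)]; exact hsq x
  have hbd : ∀ x, Real.exp (t * -g x ^ 2) ≤ 1 + (t ^ 2 * B ^ 2 / 2 - t) * g x ^ 2 := fun x => by
    have h1 := exp_neg_le_quadratic (x := t * g x ^ 2) (by positivity)
    rw [← mul_neg] at h1
    have h2 : g x ^ 2 * g x ^ 2 ≤ B ^ 2 * g x ^ 2 :=
      mul_le_mul_of_nonneg_right (hsq x) (sq_nonneg _)
    nlinarith [mul_le_mul_of_nonneg_left h2 (sq_nonneg t)]
  calc ∫ x, Real.exp (t * -g x ^ 2) ∂μ ≤ ∫ x, (1 + (t ^ 2 * B ^ 2 / 2 - t) * g x ^ 2) ∂μ :=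
        integral_mono_of_nonneg (Eventually.of_forall fun x => (Real.exp_pos _).le)
          ((integrable_const 1).add (hi2.const_mul _)) (Eventually.of_forall hbd)
    _ = 1 + (t ^ 2 * B ^ 2 / 2 - t) * ∫ x, g x ^ 2 ∂μ := by
        rw [integral_add (integrable_const 1) (hi2.const_mul _), integral_const_mul]
        simp
    _ = (t * -(∫ x, g x ^ 2 ∂μ) + t ^ 2 * B ^ 2 * (∫ x, g x ^ 2 ∂μ) / 2) + 1 := by ring
    _ ≤ _ := Real.add_one_le_exp _

include hs in
/-- Bernstein's inequality, with the uncentred second moment as variance proxy. -/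
lemma IsIIDSample.bernstein (hn : 0 < n) {g : ℝ → ℝ} {B : ℝ} (hg : Measurable g)
    (hB : ∀ x, |g x| ≤ B) (hv : 0 < ∫ x, g x ^ 2 ∂(law f)) {u : ℝ} (hu : 0 ≤ u) :
    P.real {ω | n * (∫ x, g x ∂(law f)) +
      (Real.sqrt (2 * u * (n * ∫ x, g x ^ 2 ∂(law f))) + B * u / 3) ≤ ∑ i, g (X i ω)} ≤
      Real.exp (-u) := by
  have := hs.isProbabilityMeasure hn
  have hB0 : 0 ≤ B := (abs_nonneg _).trans (hB 0)
  have hn' : (0 : ℝ) < n := by exact_mod_cast hn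
  set v := ∫ x, g x ^ 2 ∂(law f)
  set w := Real.sqrt (n * v) with hw
  set q := Real.sqrt (2 * u) with hq
  have hw0 : 0 < w := Real.sqrt_pos.2 (by positivity)
  have hq0 : 0 ≤ q := Real.sqrt_nonneg _
  have hw2 : w ^ 2 = n * v := Real.sq_sqrt (by positivity)
  have hq2 : q ^ 2 = 2 * u := Real.sq_sqrt (by positivity)
  have hD : 0 < w + B / 3 * q := by positivity
  -- the choice of the exponential parameter which gives exactly `e^{-u}`
  set t := q / (w + B / 3 * q) with ht
  have ht0 : 0 ≤ t := by positivity
  have hc : 1 - t * B / 3 = w / (w + B / 3 * q) := by rw [ht]; field_simp; ring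
  have htB : t * B < 3 := by
    have : 0 < 1 - t * B / 3 := by rw [hc]; positivity
    linarith
  refine (hs.chernoff hg hB ht0 (integral_exp_mul_le hg hB ht0 htB) _).trans (le_of_eq ?_)
  congr 1
  rw [hc, Real.sqrt_mul (by positivity), ← hq, ← hw]
  have hu' : u = q ^ 2 / 2 := by linarith
  have e : (n : ℝ) * (t ^ 2 * v / (2 * (w / (w + B / 3 * q)))) =
      t ^ 2 * w ^ 2 / (2 * (w / (w + B / 3 * q))) := by rw [hw2]; ring
  rw [e, hu', ht]
  field_simp
  ring

include hs in
lemma IsIIDSample.bernstein_abs (hn : 0 < n) {g : ℝ → ℝ} {B : ℝ} (hg : Measurable g)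
    (hB : ∀ x, |g x| ≤ B) (hv : 0 < ∫ x, g x ^ 2 ∂(law f)) {u : ℝ} (hu : 0 ≤ u) :
    P.real {ω | Real.sqrt (2 * u * (n * ∫ x, g x ^ 2 ∂(law f))) + B * u / 3 ≤
      |∑ i, g (X i ω) - n * ∫ x, g x ∂(law f)|} ≤ 2 * Real.exp (-u) := by
  have h1 := hs.bernstein hn hg hB hv hu
  have h2 := hs.bernstein hn (g := fun x => -g x) hg.neg (fun x => by rw [abs_neg]; exact hB x)
    (by simpa using hv) hu
  simp only [neg_sq, integral_neg, Finset.sum_neg_distrib] at h2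
  rw [two_mul (Real.exp (-u))]
  refine le_trans (measureReal_mono (fun ω hω => ?_) (measure_ne_top _ _))
    ((measureReal_union_le _ _).trans (add_le_add h1 h2))
  simp only [Set.mem_ofPred_eq, Set.mem_union] at hω ⊢
  rcases le_abs.1 hω with h | h
  · left; linarith
  · right; linarith

include hs in
/-- Lower tail of the empirical second moment. -/
lemma IsIIDSample.sum_sq_lower_tail (hn : 0 < n) {g : ℝ → ℝ} {B : ℝ} (hg : Measurable g)
    (hB : ∀ x, |g x| ≤ B) (hv : 0 < ∫ x, g x ^ 2 ∂(law f)) {u : ℝ} (hu : 0 ≤ u) :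
    P.real {ω | ∑ i, g (X i ω) ^ 2 ≤ n * (∫ x, g x ^ 2 ∂(law f)) -
      Real.sqrt (2 * u * (n * ∫ x, g x ^ 2 ∂(law f))) * B} ≤ Real.exp (-u) := by
  have := hs.isProbabilityMeasure hn
  have hn' : (0 : ℝ) < n := by exact_mod_cast hn
  have hB0 : 0 < B := by
    rcases ((abs_nonneg _).trans (hB 0)).lt_or_eq with h | h
    · exact h
    · exfalso
      have : ∀ x, g x = 0 := fun x => abs_eq_zero.1 (le_antisymm (h ▸ hB x) (abs_nonneg _))
      simp [this] at hv
  set v := ∫ x, g x ^ 2 ∂(law f) with hvdef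
  set r := Real.sqrt (2 * u * (n * v)) with hr
  have hr2 : r ^ 2 = 2 * u * (n * v) := Real.sq_sqrt (by positivity)
  have hr0 : 0 ≤ r := Real.sqrt_nonneg _
  -- the minimizer of the exponent `-t r B + n t² B² v / 2`
  set t := r * B / (n * B ^ 2 * v) with ht
  have ht0 : 0 ≤ t := by positivity
  have hM := integral_exp_neg_sq_le (μ := law f) hg hB ht0
  have hc := hs.chernoff (g := fun x => -g x ^ 2) (B := B ^ 2) (hg.pow_const 2).neg
    (fun x => by rw [abs_neg, abs_pow]; exact pow_le_pow_left₀ (abs_nonneg _) (hB x) 2)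
    ht0 hM (r * B)
  simp only [Finset.sum_neg_distrib] at hc
  refine le_trans (measureReal_mono (fun ω hω => ?_) (measure_ne_top _ _)) (hc.trans (le_of_eq ?_))
  · simp only [Set.mem_ofPred_eq] at hω ⊢; linarith
  · congr 1
    rw [← hvdef]
    have h1 : u = r ^ 2 / (2 * (n * v)) := by rw [hr2]; field_simp
    rw [h1, ht]
    field_simp
    ring

include hs in
lemma IsIIDSample.integral_exp_sub_le (hn : 0 < n) {g : ℝ → ℝ} {B : ℝ} (hg : Measurable g)
    (hB : ∀ x, |g x| ≤ B) {t : ℝ} (ht : 0 ≤ t) (htB : t * B ≤ 1) :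
    ∫ ω, Real.exp (t * (∑ i, g (X i ω) - n * ∫ x, g x ∂(law f))) ∂P ≤
      Real.exp (3 / 4 * (n * t ^ 2 * ∫ x, g x ^ 2 ∂(law f))) := by
  have := hs.isProbabilityMeasure hn
  have h1 := hs.mgf_sum_le hg (integral_exp_mul_le (μ := law f) hg hB ht (by linarith))
  have hv : 0 ≤ ∫ x, g x ^ 2 ∂(law f) := integral_nonneg fun _ => sq_nonneg _
  have h2 : ∀ ω, Real.exp (t * (∑ i, g (X i ω) - n * ∫ x, g x ∂(law f))) =
      Real.exp (-(t * (n * ∫ x, g x ∂(law f)))) * Real.exp (t * ∑ i, g (X i ω)) := fun ω => by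
    rw [← Real.exp_add]; congr 1; ring
  simp_rw [h2]
  rw [integral_const_mul]
  refine (mul_le_mul_of_nonneg_left h1 (Real.exp_pos _).le).trans ?_
  rw [← Real.exp_add, Real.exp_le_exp, ← add_assoc, neg_add_cancel, zero_add]
  have h3 : t ^ 2 * (∫ x, g x ^ 2 ∂(law f)) / (2 * (1 - t * B / 3)) ≤
      t ^ 2 * (∫ x, g x ^ 2 ∂(law f)) / (4 / 3) := by
    apply div_le_div_of_nonneg_left (by positivity) (by norm_num)
    linarith
  calc (n : ℝ) * (t ^ 2 * (∫ x, g x ^ 2 ∂(law f)) / (2 * (1 - t * B / 3)))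
      ≤ n * (t ^ 2 * (∫ x, g x ^ 2 ∂(law f)) / (4 / 3)) := by gcongr
    _ = _ := by ring

include hs in
/-- Hyperbolic-cosine moment of the centred sum at its natural scale. -/
lemma IsIIDSample.integral_cosh_le (hn : 0 < n) {g : ℝ → ℝ} {B : ℝ} (hg : Measurable g)
    (hB : ∀ x, |g x| ≤ B) {t : ℝ} (ht : 0 ≤ t) (htB : t * B ≤ 1)
    (htv : n * t ^ 2 * (∫ x, g x ^ 2 ∂(law f)) ≤ 1) :
    Integrable (fun ω => Real.cosh (t * (∑ i, g (X i ω) - n * ∫ x, g x ∂(law f)))) P ∧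
    ∫ ω, Real.cosh (t * (∑ i, g (X i ω) - n * ∫ x, g x ∂(law f))) ∂P ≤ 3 := by
  have h1 := hs.integral_exp_sub_le hn hg hB ht htB
  have h2 := hs.integral_exp_sub_le hn (g := fun x => -g x) hg.neg
    (fun x => by rw [abs_neg]; exact hB x) ht htB
  have e1 : ∀ ω, Real.exp (t * (∑ i, g (X i ω) - n * ∫ x, g x ∂(law f))) =
      Real.exp (-(t * (n * ∫ x, g x ∂(law f)))) * Real.exp (t * ∑ i, g (X i ω)) := fun ω => by
    rw [← Real.exp_add]; congr 1; ring
  have e2 : ∀ ω, Real.exp (-(t * (∑ i, g (X i ω) - n * ∫ x, g x ∂(law f)))) =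
      Real.exp (t * (n * ∫ x, g x ∂(law f))) * Real.exp (-t * ∑ i, g (X i ω)) := fun ω => by
    rw [← Real.exp_add]; congr 1; ring
  have i1 : Integrable (fun ω => Real.exp (t * (∑ i, g (X i ω) - n * ∫ x, g x ∂(law f)))) P := by
    simp_rw [e1]; exact (hs.integrable_exp_sum hg hB t).const_mul _
  have i2 : Integrable
      (fun ω => Real.exp (-(t * (∑ i, g (X i ω) - n * ∫ x, g x ∂(law f))))) P := by
    simp_rw [e2]; exact (hs.integrable_exp_sum hg hB (-t)).const_mul _
  simp only [neg_sq, integral_neg, Finset.sum_neg_distrib] at h2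
  have h2' : ∫ ω, Real.exp (-(t * (∑ i, g (X i ω) - n * ∫ x, g x ∂(law f)))) ∂P ≤
      Real.exp (3 / 4 * (n * t ^ 2 * ∫ x, g x ^ 2 ∂(law f))) := by
    refine le_of_eq_of_le ?_ h2
    congr 1; ext ω; congr 1; ring
  have h3 : Real.exp (3 / 4 * (n * t ^ 2 * ∫ x, g x ^ 2 ∂(law f))) ≤ 3 := by
    refine (Real.exp_le_exp.2 (by linarith : _ ≤ (1 : ℝ))).trans ?_
    linarith [Real.exp_one_lt_d9]
  simp_rw [Real.cosh_eq]
  refine ⟨(i1.add i2).div_const 2, ?_⟩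
  rw [integral_div, integral_add i1 i2]
  linarith

include hs in
/-- Variance of the empirical mean of `g`. -/
lemma IsIIDSample.integral_sq_error (hn : 0 < n) {g : ℝ → ℝ} {B : ℝ} (hg : Measurable g)
    (hB : ∀ x, |g x| ≤ B) :
    ∫ ω, ((1 / n : ℝ) * ∑ i, g (X i ω) - ∫ x, g x ∂(law f)) ^ 2 ∂P =
      ((∫ x, g x ^ 2 ∂(law f)) - (∫ x, g x ∂(law f)) ^ 2) / n := by
  have := hs.isProbabilityMeasure hn
  have hn' : (0 : ℝ) < n := by exact_mod_cast hn
  have hm : ∀ i, Measurable fun ω => g (X i ω) := fun i => hg.comp (hs.measurable i)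
  have hmem : ∀ i, MemLp (fun ω => g (X i ω)) 2 P := fun i =>
    MemLp.of_bound (hm i).aestronglyMeasurable B (Eventually.of_forall fun ω => hB _)
  have hind : iIndepFun (fun i => fun ω => g (X i ω)) P := hs.indep.comp (fun _ => g) fun _ => hg
  have hvar : ∀ i, variance (fun ω => g (X i ω)) P =
      (∫ x, g x ^ 2 ∂(law f)) - (∫ x, g x ∂(law f)) ^ 2 := fun i => by
    rw [variance_eq_sub (hmem i), hs.integral_comp hg i]
    congr 1
    exact hs.integral_comp (g := fun x => g x ^ 2) (hg.pow_const 2) i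
  have hsum := IndepFun.variance_sum (s := Finset.univ) (fun i _ => hmem i)
    fun i _ j _ hij => hind.indepFun hij
  simp_rw [hvar] at hsum
  have hEq : (∑ i, fun ω => g (X i ω)) = fun ω => ∑ i, g (X i ω) := by ext ω; simp
  have hint : ∫ ω, ∑ i, g (X i ω) ∂P = n * ∫ x, g x ∂(law f) := by
    rw [integral_finsetSum _ fun i _ => (hmem i).integrable one_le_two]
    simp_rw [hs.integral_comp hg]
    simp
  rw [hEq, variance_eq_integral (hs.measurable_sum hg).aemeasurable, hint] at hsum
  have e : ∀ ω, ((1 / n : ℝ) * ∑ i, g (X i ω) - ∫ x, g x ∂(law f)) ^ 2 =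
      (1 / (n : ℝ) ^ 2) * (∑ i, g (X i ω) - n * ∫ x, g x ∂(law f)) ^ 2 := fun ω => by
    field_simp
  simp_rw [e]
  rw [integral_const_mul, hsum]
  simp only [Finset.sum_const, Finset.card_univ, Fintype.card_fin, nsmul_eq_mul]
  field_simp

end Sample

/-! ### Risk of one thresholded coefficient -/

lemma integral_law {f : ℝ → ℝ} (hf : IsL2Density f) (g : ℝ → ℝ) :
    ∫ x, g x ∂(law f) = coef f g := by
  have hm : AEMeasurable f (volume.restrict (Set.Icc 0 1)) :=
    hf.memLp.aestronglyMeasurable.aemeasurable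
  rw [law, integral_withDensity_eq_integral_toReal_smul₀ hm.ennreal_ofReal
    (Eventually.of_forall fun _ => ENNReal.ofReal_lt_top), coef,
    intervalIntegral.integral_of_le zero_le_one, ← integral_Icc_eq_integral_Ioc]
  refine setIntegral_congr_fun measurableSet_Icc fun x hx => ?_
  simp only [ENNReal.toReal_ofReal (hf.nonneg x hx), smul_eq_mul]

lemma integral_law_sq_le {f : ℝ → ℝ} (hf : IsL2Density f) (hb : BoundedOnUnit f) {g : ℝ → ℝ}
    (hg : Continuous g) : ∫ x, g x ^ 2 ∂(law f) ≤ supNorm f * ∫ x in (0 : ℝ)..1, g x ^ 2 := by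
  rw [integral_law hf fun x => g x ^ 2, coef, ← intervalIntegral.integral_const_mul]
  refine intervalIntegral.integral_mono_on zero_le_one
    (IsL2.intervalIntegrable_mul hf.memLp (isL2_of_continuous (hg.pow 2)))
    (((continuous_const.mul (hg.pow 2))).intervalIntegrable _ _) fun x hx => ?_
  exact mul_le_mul_of_nonneg_right ((le_abs_self _).trans (le_ciSup hb ⟨x, hx⟩)) (sq_nonneg _)

/-- Solving the empirical variance inequality for the true variance. -/
lemma le_add_sqrt_of_sub_lt {W A u B : ℝ} (hW : 0 ≤ W) (hA : 0 ≤ A) (hB : 0 ≤ B)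
    (h : W - Real.sqrt (2 * u * W) * B < A) (hu : 0 ≤ u) :
    W ≤ A + Real.sqrt (2 * u * A) * B + 2 * u * B ^ 2 := by
  rw [Real.sqrt_mul (by positivity)] at h ⊢
  set r := Real.sqrt (2 * u) with hr
  set x := Real.sqrt W with hx
  set a := Real.sqrt A with ha
  have hr2 : r ^ 2 = 2 * u := Real.sq_sqrt (by positivity)
  have hx2 : x ^ 2 = W := Real.sq_sqrt hW
  have ha2 : a ^ 2 = A := Real.sq_sqrt hA
  have hr0 : 0 ≤ r * B := mul_nonneg (Real.sqrt_nonneg _) hB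
  have ha0 : 0 ≤ a := Real.sqrt_nonneg _
  have hxs : x ≤ a + r * B := by
    by_contra! hlt
    nlinarith [mul_pos (sub_pos.2 hlt) (by linarith : 0 < x)]
  rw [← hr2, ← hx2, ← ha2]
  rw [← hx2, ← ha2] at h
  nlinarith [mul_le_mul_of_nonneg_right hxs hr0]

lemma sqrt_mul_sq (x : ℝ) {y : ℝ} (hy : 0 ≤ y) : Real.sqrt (x * y ^ 2) = Real.sqrt x * y := by
  rw [Real.sqrt_mul' x (sq_nonneg y), Real.sqrt_sq hy]

lemma two_le_kappa : 2 ≤ kappa := by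
  have : (1 : ℝ) ≤ Real.sqrt (5 / 3) := Real.one_le_sqrt.2 (by norm_num)
  rw [kappa]; linarith

lemma kappa_le : kappa ≤ 3 := by
  have : Real.sqrt (5 / 3) ≤ 5 / 3 := Real.sqrt_le_iff.2 ⟨by norm_num, by norm_num⟩
  rw [kappa]; linarith

namespace IsTrigPoly

variable {g : ℝ → ℝ} {S : Finset ℤ} (hg : IsTrigPoly g S)
include hg

lemma threshold_mul {n : ℕ} (hn : 0 < n) (X : Fin n → ℝ) {δ : ℝ} :
    threshold X δ g * n =
      Real.sqrt (2 * (δ * Real.log n) * ((∑ m, g (X m) ^ 2) +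
        Real.sqrt (2 * (δ * Real.log n) * ∑ m, g (X m) ^ 2) * fourierL1 g +
        δ * Real.log n * kappa * fourierL1 g ^ 2)) + δ * Real.log n * fourierL1 g / 3 := by
  have hn' : (0 : ℝ) < n := by exact_mod_cast hn
  have hB := hg.fourierL1_nonneg
  rw [threshold, hg.empVar_eq, add_mul]
  set A := ∑ m, g (X m) ^ 2
  set B := fourierL1 g
  congr 1
  · have hs : Real.sqrt (2 * δ * Real.log n * (1 / (n : ℝ) ^ 2 * A) * (B ^ 2 / (n : ℝ) ^ 2)) =
        Real.sqrt (2 * (δ * Real.log n) * A) * B / (n : ℝ) ^ 2 := by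
      rw [show 2 * δ * Real.log n * (1 / (n : ℝ) ^ 2 * A) * (B ^ 2 / (n : ℝ) ^ 2) =
        2 * (δ * Real.log n) * A * (B / (n : ℝ) ^ 2) ^ 2 by field_simp,
        sqrt_mul_sq _ (by positivity), mul_div_assoc]
    rw [hs, ← sqrt_mul_sq _ hn'.le]
    congr 1
    field_simp
  · field_simp

lemma threshold_nonneg {n : ℕ} (X : Fin n → ℝ) {δ : ℝ} (hδ : 0 ≤ δ) : 0 ≤ threshold X δ g := by
  have hB := hg.fourierL1_nonneg
  have hL : 0 ≤ Real.log n := Real.log_natCast_nonneg n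
  exact add_nonneg (Real.sqrt_nonneg _) (by positivity)

/-- Size of the threshold. -/
lemma threshold_sq_le {n : ℕ} (hn : 0 < n) (X : Fin n → ℝ) {δ : ℝ} (hδ : 0 ≤ δ) :
    threshold X δ g ^ 2 ≤ 6 * δ * Real.log n * empVar X g +
      17 * δ ^ 2 * (Real.log n ^ 2 * fourierL1 g ^ 2 / (n : ℝ) ^ 2) := by
  have hn' : (0 : ℝ) < n := by exact_mod_cast hn
  have hB := hg.fourierL1_nonneg
  have ht := hg.threshold_mul hn X (δ := δ)
  rw [hg.empVar_eq]
  set A := ∑ m, g (X m) ^ 2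
  have hA : 0 ≤ A := Finset.sum_nonneg fun _ _ => sq_nonneg _
  set B := fourierL1 g
  have hd : 0 ≤ δ * Real.log n := mul_nonneg hδ (Real.log_natCast_nonneg n)
  set d := δ * Real.log n with hddef
  have hk := two_le_kappa
  have hk3 := kappa_le
  have h1 : Real.sqrt (2 * d * A) * B ≤ (A + 2 * d * B ^ 2) / 2 := by
    rw [Real.sqrt_mul (by positivity)]
    have e1 : Real.sqrt (2 * d) ^ 2 = 2 * d := Real.sq_sqrt (by positivity)
    have e2 : Real.sqrt A ^ 2 = A := Real.sq_sqrt hA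
    nlinarith [sq_nonneg (Real.sqrt (2 * d) * B - Real.sqrt A)]
  set Q := A + Real.sqrt (2 * d * A) * B + d * kappa * B ^ 2 with hQ
  have hQ0 : 0 ≤ Q := by positivity
  have hQle : Q ≤ 3 / 2 * A + 4 * d * B ^ 2 := by
    have : d * kappa * B ^ 2 ≤ d * 3 * B ^ 2 := by gcongr
    rw [hQ]; linarith
  have h2 : (threshold X δ g * n) ^ 2 ≤ 6 * d * A + 17 * (d ^ 2 * B ^ 2) := by
    have e3 : Real.sqrt (2 * d * Q) ^ 2 = 2 * d * Q := Real.sq_sqrt (by positivity)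
    rw [ht]
    have h3 : d * Q ≤ d * (3 / 2 * A + 4 * d * B ^ 2) := mul_le_mul_of_nonneg_left hQle hd
    nlinarith [sq_nonneg (Real.sqrt (2 * d * Q) - d * B / 3), sq_nonneg (d * B)]
  have h4 : threshold X δ g ^ 2 = (threshold X δ g * n) ^ 2 / (n : ℝ) ^ 2 := by field_simp
  rw [h4, div_le_iff₀ (by positivity)]
  refine h2.trans (le_of_eq ?_)
  rw [hddef]; field_simp

/-- The threshold exceeds the Bernstein deviation unless the empirical variance is too small. -/
lemma bernstein_le_threshold {n : ℕ} (hn : 0 < n) (X : Fin n → ℝ) {δ θ W : ℝ} (hδ : 0 ≤ δ)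
    (hθ : 0 ≤ θ) (hθ1 : θ ≤ 1) (hW : 0 ≤ W)
    (h : W - Real.sqrt (2 * (θ ^ 2 * (δ * Real.log n)) * W) * fourierL1 g < ∑ m, g (X m) ^ 2) :
    Real.sqrt (2 * (θ ^ 2 * (δ * Real.log n)) * W) +
      fourierL1 g * (θ ^ 2 * (δ * Real.log n)) / 3 ≤ θ * threshold X δ g * n := by
  have hB := hg.fourierL1_nonneg
  have hA : 0 ≤ ∑ m, g (X m) ^ 2 := Finset.sum_nonneg fun _ _ => sq_nonneg _
  have hd : 0 ≤ δ * Real.log n := mul_nonneg hδ (Real.log_natCast_nonneg n)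
  rw [mul_assoc θ, hg.threshold_mul hn X]
  set d := δ * Real.log n
  set A := ∑ m, g (X m) ^ 2
  set B := fourierL1 g
  have hθ2 : θ ^ 2 ≤ 1 := pow_le_one₀ hθ hθ1
  have hu : θ ^ 2 * d ≤ d := mul_le_of_le_one_left hd hθ2
  have h1 := le_add_sqrt_of_sub_lt hW hA hB h (by positivity)
  have h2 : W ≤ A + Real.sqrt (2 * d * A) * B + d * kappa * B ^ 2 := by
    refine h1.trans (add_le_add (by gcongr) ?_)
    have : 2 * (θ ^ 2 * d) ≤ d * kappa := by nlinarith [two_le_kappa]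
    gcongr
  have h3 : Real.sqrt (2 * (θ ^ 2 * d) * W) = θ * Real.sqrt (2 * d * W) := by
    rw [show 2 * (θ ^ 2 * d) * W = 2 * d * W * θ ^ 2 by ring, sqrt_mul_sq _ hθ]
    ring
  rw [h3, mul_add]
  refine add_le_add (by gcongr) ?_
  have : θ ^ 2 * (B * d) ≤ θ * (B * d) := by
    apply mul_le_mul_of_nonneg_right _ (by positivity)
    nlinarith
  linarith

end IsTrigPoly

/-- Hard thresholding: the loss is comparable to that of an oracle unless the error exceeds the
fraction `θ` of the threshold, in which case it is at most a multiple of the squared error. -/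
lemma thresholded_sq_le {n : ℕ} (X : Fin n → ℝ) {δ θ b : ℝ} {g : ℝ → ℝ} (hθ : 0 < θ) (hθ1 : θ < 1)
    (hτ : 0 ≤ threshold X δ g) :
    (thresholded X δ g - b) ^ 2 ≤
      ((1 - θ) ^ 2)⁻¹ * min (b ^ 2) ((empCoef X g - b) ^ 2) +
      min (b ^ 2) (4 * threshold X δ g ^ 2) +
      4 / θ ^ 2 *
        (if θ * threshold X δ g < |empCoef X g - b| then (empCoef X g - b) ^ 2 else 0) := by
  rw [thresholded]
  set τ := threshold X δ g
  set e := empCoef X g - b with he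
  have hx : empCoef X g = b + e := by rw [he]; ring
  rw [hx]
  have h1θ : 0 < 1 - θ := by linarith
  have hm1 : 0 ≤ min (b ^ 2) (e ^ 2) := le_min (sq_nonneg _) (sq_nonneg _)
  have hm2 : 0 ≤ min (b ^ 2) (4 * τ ^ 2) := le_min (sq_nonneg _) (by positivity)
  have hm1' : 0 ≤ ((1 - θ) ^ 2)⁻¹ * min (b ^ 2) (e ^ 2) := by positivity
  have hc1 : 1 ≤ ((1 - θ) ^ 2)⁻¹ :=
    (one_le_inv₀ (by positivity)).2 (pow_le_one₀ h1θ.le (by linarith))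
  have hc2 : 1 ≤ 4 / θ ^ 2 := by rw [le_div_iff₀ (by positivity)]; nlinarith
  by_cases hbad : θ * τ < |e|
  · rw [if_pos hbad]
    suffices h : ((if τ ≤ |b + e| then b + e else 0) - b) ^ 2 ≤ 4 / θ ^ 2 * e ^ 2 by linarith
    split_ifs with hk
    · rw [add_sub_cancel_left]; exact le_mul_of_one_le_left (sq_nonneg _) hc2
    · push Not at hk
      have h1 : |b| ≤ |b + e| + |e| := by
        have := abs_sub (b + e) e
        rwa [add_sub_cancel_right] at this
      have h2 : θ * |b| ≤ 2 * |e| := by nlinarith [abs_nonneg e]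
      have h3 : (θ * |b|) ^ 2 ≤ (2 * |e|) ^ 2 := pow_le_pow_left₀ (by positivity) h2 2
      rw [mul_pow, mul_pow, sq_abs, sq_abs] at h3
      rw [zero_sub, neg_sq, div_mul_eq_mul_div, le_div_iff₀ (by positivity)]
      linarith
  · rw [if_neg hbad, mul_zero, add_zero]
    push Not at hbad
    split_ifs with hk
    · rw [add_sub_cancel_left]
      suffices h : e ^ 2 ≤ ((1 - θ) ^ 2)⁻¹ * min (b ^ 2) (e ^ 2) by linarith
      rw [← div_eq_inv_mul, le_div_iff₀ (by positivity), le_min_iff]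
      have h1 : |b + e| ≤ |b| + |e| := abs_add_le _ _
      have h2 : |e| * (1 - θ) ≤ |b| := by nlinarith
      constructor
      · have := pow_le_pow_left₀ (by positivity) h2 2
        rwa [mul_pow, sq_abs, sq_abs] at this
      · exact mul_le_of_le_one_right (sq_nonneg _) (pow_le_one₀ h1θ.le (by linarith))
    · push Not at hk
      rw [zero_sub, neg_sq]
      suffices h : b ^ 2 ≤ min (b ^ 2) (4 * τ ^ 2) by linarith
      refine le_min le_rfl ?_
      have h1 : |b| ≤ |b + e| + |e| := by
        have := abs_sub (b + e) e
        rwa [add_sub_cancel_right] at this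
      have h2 : |b| ≤ 2 * τ := by nlinarith
      have := pow_le_pow_left₀ (abs_nonneg b) h2 2
      rw [mul_pow, sq_abs] at this
      linarith

lemma sq_le_cosh_rpow {ε : ℝ} (hε : 0 < ε) (hε1 : ε ≤ 1) (x : ℝ) :
    x ^ 2 ≤ 4 / ε ^ 2 * Real.cosh x ^ ε := by
  have h1 := Real.quadratic_le_exp_of_nonneg (x := ε * |x|) (by positivity)
  have h2 : Real.exp (ε * |x|) ≤ 2 * Real.cosh x ^ ε := by
    have h3 : Real.exp |x| ≤ 2 * Real.cosh x := by
      rw [← Real.cosh_abs, Real.cosh_eq]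
      linarith [Real.exp_pos (-|x|)]
    calc Real.exp (ε * |x|) = Real.exp |x| ^ ε := by rw [mul_comm, Real.exp_mul]
      _ ≤ (2 * Real.cosh x) ^ ε := Real.rpow_le_rpow (Real.exp_pos _).le h3 hε.le
      _ = 2 ^ ε * Real.cosh x ^ ε := Real.mul_rpow (by norm_num) (Real.cosh_pos x).le
      _ ≤ 2 * Real.cosh x ^ ε := by
        refine mul_le_mul_of_nonneg_right ?_ (Real.rpow_nonneg (Real.cosh_pos x).le _)
        calc (2 : ℝ) ^ ε ≤ 2 ^ (1 : ℝ) := Real.rpow_le_rpow_of_exponent_le (by norm_num) hε1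
          _ = 2 := Real.rpow_one 2
  have h4 : (ε * |x|) ^ 2 = ε ^ 2 * x ^ 2 := by rw [mul_pow, sq_abs]
  rw [div_mul_eq_mul_div, le_div_iff₀ (by positivity)]
  nlinarith [mul_nonneg hε.le (abs_nonneg x)]

/-- Splitting at `cosh x = M` replaces Hölder's inequality: over an event of probability at most
`1 / M`, the expectations of both terms on the right are of order `M ^ (ε - 1)`. -/
lemma sq_le_of_cosh {ε M : ℝ} (hε : 0 < ε) (hε1 : ε < 1) (hM : 0 < M) (x : ℝ) :
    x ^ 2 ≤ 4 / ε ^ 2 * (M ^ ε + M ^ (ε - 1) * Real.cosh x) := by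
  refine (sq_le_cosh_rpow hε hε1.le x).trans (mul_le_mul_of_nonneg_left ?_ (by positivity))
  have hc := Real.cosh_pos x
  rcases le_or_gt (Real.cosh x) M with h | h
  · have h1 : Real.cosh x ^ ε ≤ M ^ ε := Real.rpow_le_rpow hc.le h hε.le
    have h2 : 0 ≤ M ^ (ε - 1) * Real.cosh x := by positivity
    linarith
  · have h1 : Real.cosh x ^ ε = Real.cosh x ^ (ε - 1) * Real.cosh x := by
      rw [← Real.rpow_add_one hc.ne']; congr 1; ring
    have h2 : Real.cosh x ^ (ε - 1) ≤ M ^ (ε - 1) :=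
      Real.rpow_le_rpow_of_nonpos hM h.le (by linarith)
    have h3 : 0 ≤ M ^ ε := by positivity
    rw [h1]
    nlinarith [mul_le_mul_of_nonneg_right h2 hc.le]

lemma IsTrigPoly.error_mul {n : ℕ} (hn : 0 < n) {f g : ℝ → ℝ} (hf : IsL2Density f) {S : Finset ℤ}
    (hg : IsTrigPoly g S) (x : Fin n → ℝ) :
    (empCoef x g - coef f g) * n = ∑ i, g (x i) - n * ∫ x, g x ∂(law f) := by
  have hn' : (n : ℝ) ≠ 0 := by exact_mod_cast hn.ne'
  rw [hg.empCoef_eq, integral_law hf]; field_simp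

section Sample

variable {Ω : Type*} [MeasurableSpace Ω] {P : Measure Ω} {n : ℕ}
  {X : Fin n → Ω → ℝ} {f : ℝ → ℝ} (hs : IsIIDSample P f X)
  {g : ℝ → ℝ} {S : Finset ℤ} (hg : IsTrigPoly g S)
include hs hg

lemma IsIIDSample.measurable_empCoef : Measurable fun ω => empCoef (fun i => X i ω) g := by
  simp_rw [hg.empCoef_eq]
  exact (hs.measurable_sum hg.continuous.measurable).const_mul _

lemma IsIIDSample.measurable_empVar : Measurable fun ω => empVar (fun i => X i ω) g := by
  simp_rw [hg.empVar_eq]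
  exact (hs.measurable_sum (g := fun x => g x ^ 2)
    (hg.continuous.measurable.pow_const 2)).const_mul _

lemma IsIIDSample.measurable_threshold (δ : ℝ) :
    Measurable fun ω => threshold (fun i => X i ω) δ g := by
  have := hs.measurable_empVar hg
  unfold threshold
  fun_prop

variable [IsProbabilityMeasure P] (hf : IsL2Density f) (hn : 0 < n)
include hf hn

/-- The error of an empirical coefficient rarely exceeds a fixed fraction of the random threshold:
Bernstein's inequality together with the lower tail of the empirical variance. -/
lemma IsIIDSample.error_tail {δ θ : ℝ} (hδ : 0 ≤ δ) (hθ : 0 ≤ θ) (hθ1 : θ ≤ 1) :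
    P.real {ω | θ * threshold (fun i => X i ω) δ g < |empCoef (fun i => X i ω) g - coef f g|} ≤
      3 * Real.exp (-(θ ^ 2 * (δ * Real.log n))) := by
  have := hs.isProbabilityMeasure hn
  have hn' : (0 : ℝ) < n := by exact_mod_cast hn
  have hgm := hg.continuous.measurable
  have hgB := hg.abs_le_fourierL1
  have hu : 0 ≤ θ ^ 2 * (δ * Real.log n) :=
    mul_nonneg (sq_nonneg _) (mul_nonneg hδ (Real.log_natCast_nonneg n))
  have hv0 : 0 ≤ ∫ x, g x ^ 2 ∂(law f) := integral_nonneg fun _ => sq_nonneg _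
  rcases hv0.eq_or_lt with hv | hv
  · -- degenerate case: `g` vanishes at all observations, so that there is no error at all
    have hi2 : Integrable (fun x => g x ^ 2) (law f) := integrable_of_abs_le
      (B := fourierL1 g ^ 2) (hgm.pow_const 2)
      fun x => by rw [abs_pow]; exact pow_le_pow_left₀ (abs_nonneg _) (hgB x) 2
    have h0 := (integral_eq_zero_iff_of_nonneg (fun x => sq_nonneg (g x)) hi2).1 hv.symm
    have h1 : ∀ᵐ x ∂(law f), g x = 0 := h0.mono fun x hx => pow_eq_zero_iff two_ne_zero |>.1 hx
    have h2 : ∀ i, ∀ᵐ ω ∂P, g (X i ω) = 0 := fun i =>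
      ae_of_ae_map (hs.measurable i).aemeasurable (by rw [hs.map_eq i]; exact h1)
    have h3 : ∀ᵐ ω ∂P, ∀ i, g (X i ω) = 0 := ae_all_iff.2 h2
    have h4 : P {ω | θ * threshold (fun i => X i ω) δ g <
        |empCoef (fun i => X i ω) g - coef f g|} = 0 := by
      refine measure_mono_null (t := {ω | ¬ ∀ i, g (X i ω) = 0}) (fun ω hω hω' => ?_) h3
      have e := hg.error_mul hn hf fun i => X i ω
      rw [integral_congr_ae h1] at e
      simp only [hω', Finset.sum_const_zero, integral_zero, mul_zero, sub_zero] at e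
      have e0 : empCoef (fun i => X i ω) g - coef f g = 0 :=
        (mul_eq_zero.1 e).resolve_right hn'.ne'
      rw [Set.mem_ofPred_eq, e0, abs_zero] at hω
      exact absurd hω (not_lt.2 (mul_nonneg hθ (hg.threshold_nonneg _ hδ)))
    rw [Measure.real, h4, ENNReal.toReal_zero]
    positivity
  · have h1 := hs.bernstein_abs hn hgm hgB hv hu
    have h2 := hs.sum_sq_lower_tail hn hgm hgB hv hu
    rw [show 3 * Real.exp (-(θ ^ 2 * (δ * Real.log n))) =
      2 * Real.exp (-(θ ^ 2 * (δ * Real.log n))) + Real.exp (-(θ ^ 2 * (δ * Real.log n))) by ring]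
    refine le_trans (measureReal_mono (fun ω hω => ?_) (measure_ne_top _ _))
      ((measureReal_union_le _ _).trans (add_le_add h1 h2))
    by_contra hcon
    simp only [Set.mem_union, Set.mem_ofPred_eq, not_or, not_le] at hcon hω
    have h3 := hg.bernstein_le_threshold hn (fun i => X i ω) hδ hθ hθ1 (by positivity) hcon.2
    have h4 := mul_lt_mul_of_pos_right hω hn'
    rw [← abs_of_pos hn', ← abs_mul, hg.error_mul hn hf (fun i => X i ω), abs_of_pos hn'] at h4
    linarith [hcon.1]

omit hf in
lemma IsIIDSample.integrable_sq_error (b : ℝ) :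
    Integrable (fun ω => (empCoef (fun i => X i ω) g - b) ^ 2) P := by
  have hn' : (0 : ℝ) < n := by exact_mod_cast hn
  refine Integrable.of_bound
    (((hs.measurable_empCoef hg).sub_const b).pow_const 2).aestronglyMeasurable
    ((fourierL1 g + |b|) ^ 2) (Eventually.of_forall fun ω => ?_)
  rw [Real.norm_eq_abs, abs_pow]
  refine pow_le_pow_left₀ (abs_nonneg _) ((abs_sub _ _).trans (add_le_add ?_ le_rfl)) 2
  rw [hg.empCoef_eq, abs_mul, abs_of_pos (by positivity)]
  calc (1 / n : ℝ) * |∑ i, g (X i ω)| ≤ (1 / n : ℝ) * (n * fourierL1 g) := by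
        gcongr; exact abs_sum_comp_le hg.abs_le_fourierL1 ω
    _ = fourierL1 g := by field_simp

lemma IsIIDSample.coefVar_eq :
    coefVar P f X g = (∫ x, g x ^ 2 ∂(law f)) / n - coef f g ^ 2 / n := by
  have h := hs.integral_sq_error hn hg.continuous.measurable hg.abs_le_fourierL1
  rw [integral_law hf g, sub_div] at h
  rw [coefVar, ← h]
  simp_rw [hg.empCoef_eq]

omit hf in
lemma IsIIDSample.integral_empVar : Integrable (fun ω => empVar (fun i => X i ω) g) P ∧
    ∫ ω, empVar (fun i => X i ω) g ∂P = (∫ x, g x ^ 2 ∂(law f)) / n := by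
  have hn' : (0 : ℝ) < n := by exact_mod_cast hn
  have hm : Measurable fun x => g x ^ 2 := hg.continuous.measurable.pow_const 2
  have hi : ∀ i, Integrable (fun ω => g (X i ω) ^ 2) P := fun i => by
    refine Integrable.of_bound (hm.comp (hs.measurable i)).aestronglyMeasurable
      (fourierL1 g ^ 2) (Eventually.of_forall fun ω => ?_)
    rw [Real.norm_eq_abs, abs_pow]
    exact pow_le_pow_left₀ (abs_nonneg _) (hg.abs_le_fourierL1 _) 2
  simp_rw [hg.empVar_eq]
  refine ⟨(integrable_finsetSum _ fun i _ => hi i).const_mul _, ?_⟩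
  rw [integral_const_mul, integral_finsetSum _ fun i _ => hi i]
  simp_rw [hs.integral_comp hm]
  simp only [Finset.sum_const, Finset.card_univ, Fintype.card_fin, nsmul_eq_mul]
  field_simp

/-- Expected squared error on the event that the threshold XX -/
lemma IsIIDSample.exists_dominating_bad {δ θ ε B M : ℝ} (hδ : 0 ≤ δ) (hθ : 0 ≤ θ) (hθ1 : θ ≤ 1)
    (hε : 0 < ε) (hε1 : ε < 1) (hB : 0 < B) (hgB : fourierL1 g ≤ B)
    (hM : M = Real.exp (θ ^ 2 * (δ * Real.log n))) :
    ∃ R : Ω → ℝ, Integrable R P ∧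
      (∀ ω, (if θ * threshold (fun i => X i ω) δ g < |empCoef (fun i => X i ω) g - coef f g|
        then (empCoef (fun i => X i ω) g - coef f g) ^ 2 else 0) ≤ R ω) ∧
      ∫ ω, R ω ∂P ≤ 24 / ε ^ 2 * (((∫ x, g x ^ 2 ∂(law f)) / n + B ^ 2 / (n : ℝ) ^ 2) *
        M ^ (ε - 1)) := by
  have hn' : (0 : ℝ) < n := by exact_mod_cast hn
  have hM0 : 0 < M := hM ▸ Real.exp_pos _
  have hgm := hg.continuous.measurable
  set v := ∫ x, g x ^ 2 ∂(law f) with hv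
  have hv0 : 0 ≤ v := integral_nonneg fun _ => sq_nonneg _
  set s := v / n + B ^ 2 / (n : ℝ) ^ 2 with hsdef
  have hs0 : 0 < s := by positivity
  have hss : Real.sqrt s ^ 2 = s := Real.sq_sqrt hs0.le
  have hsp : 0 < Real.sqrt s := Real.sqrt_pos.2 hs0
  set A : Set Ω := {ω | θ * threshold (fun i => X i ω) δ g <
    |empCoef (fun i => X i ω) g - coef f g|} with hA
  have hAm : MeasurableSet A := measurableSet_lt ((hs.measurable_threshold hg δ).const_mul θ)
    (continuous_abs.measurable.comp ((hs.measurable_empCoef hg).sub_const _))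
  have hAi : Integrable (A.indicator (1 : Ω → ℝ)) P := (integrable_const (1 : ℝ)).indicator hAm
  -- the normalization for which `t (∑ g (X i) - n E g)` is the error divided by its scale `√s`
  set t : ℝ := 1 / (n * Real.sqrt s) with ht
  have ht0 : 0 ≤ t := by positivity
  have htB : t * B ≤ 1 := by
    have h1 : (B / n) ^ 2 ≤ s := by rw [div_pow, hsdef]; linarith [div_nonneg hv0 hn'.le]
    have h2 := Real.le_sqrt_of_sq_le h1
    rw [ht, div_mul_eq_mul_div, one_mul, div_le_one (by positivity)]
    rw [div_le_iff₀ hn'] at h2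
    linarith
  have htv : n * t ^ 2 * v ≤ 1 := by
    have h1 : v / n ≤ s := by rw [hsdef]; linarith [show 0 ≤ B ^ 2 / (n : ℝ) ^ 2 by positivity]
    have h2 : n * t ^ 2 * v = v / n / s := by
      rw [ht, div_pow, mul_pow, hss]; field_simp
    rw [h2]; exact div_le_one_of_le₀ h1 hs0.le
  obtain ⟨hci, hc3⟩ := hs.integral_cosh_le hn hgm
    (fun x => (hg.abs_le_fourierL1 x).trans hgB) ht0 htB htv
  have hcosh : ∀ ω, (empCoef (fun i => X i ω) g - coef f g) ^ 2 ≤ s * (4 / ε ^ 2 * (M ^ ε +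
      M ^ (ε - 1) * Real.cosh (t * (∑ i, g (X i ω) - n * ∫ x, g x ∂(law f))))) := fun ω => by
    have h1 := sq_le_of_cosh hε hε1 hM0 (t * (∑ i, g (X i ω) - n * ∫ x, g x ∂(law f)))
    have h2 : (empCoef (fun i => X i ω) g - coef f g) ^ 2 =
        s * (t * (∑ i, g (X i ω) - n * ∫ x, g x ∂(law f))) ^ 2 := by
      rw [← hg.error_mul hn hf (fun i => X i ω), ht, mul_pow, div_pow, mul_pow, mul_pow, hss]
      field_simp
    rw [h2]
    exact mul_le_mul_of_nonneg_left h1 hs0.le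
  refine ⟨fun ω => s * (4 / ε ^ 2 * (M ^ ε * A.indicator 1 ω + M ^ (ε - 1) *
    Real.cosh (t * (∑ i, g (X i ω) - n * ∫ x, g x ∂(law f))))), ?_, fun ω => ?_, ?_⟩
  · exact (((hAi.const_mul _).add
      (hci.const_mul _)).const_mul _).const_mul _
  · by_cases h : θ * threshold (fun i => X i ω) δ g < |empCoef (fun i => X i ω) g - coef f g|
    · have hω : ω ∈ A := h
      simp only []
      rw [if_pos h, Set.indicator_of_mem hω, Pi.one_apply, mul_one]
      exact hcosh ω
    · have hω : ω ∉ A := h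
      simp only []
      rw [if_neg h, Set.indicator_of_notMem hω, mul_zero, zero_add]
      have := Real.cosh_pos (t * (∑ i, g (X i ω) - n * ∫ x, g x ∂(law f)))
      positivity
  · have hPA : P.real A ≤ 3 * M⁻¹ := by
      rw [hM, ← Real.exp_neg]; exact hs.error_tail hg hf hn hδ hθ hθ1
    have hMM : M ^ ε * M⁻¹ = M ^ (ε - 1) := by
      rw [Real.rpow_sub_one hM0.ne', div_eq_mul_inv]
    rw [integral_const_mul, integral_const_mul, integral_add
      (hAi.const_mul _) (hci.const_mul _),
      integral_const_mul, integral_const_mul, integral_indicator_one hAm]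
    have h1 : M ^ ε * P.real A ≤ 3 * M ^ (ε - 1) := by
      rw [← hMM]
      have := mul_le_mul_of_nonneg_left hPA (by positivity : 0 ≤ M ^ ε)
      linarith
    have h2 : M ^ (ε - 1) * ∫ ω, Real.cosh (t * (∑ i, g (X i ω) - n * ∫ x, g x ∂(law f))) ∂P ≤
        3 * M ^ (ε - 1) := by
      have := mul_le_mul_of_nonneg_left hc3 (by positivity : 0 ≤ M ^ (ε - 1))
      linarith
    calc _ ≤ s * (4 / ε ^ 2 * (3 * M ^ (ε - 1) + 3 * M ^ (ε - 1))) := by gcongr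
      _ = _ := by ring

/-- Oracle inequality for one thresholded coefficient. The loss is dominated by an integrable
function, so that losses can be added up without measurability of each of them. -/
lemma IsIIDSample.exists_dominating_thresholded {δ θ ε B η : ℝ} (hδ : 0 < δ) (hθ : 0 < θ)
    (hθ1 : θ < 1) (hε : 0 < ε) (hε1 : ε < 1) (hη : θ ^ 2 * δ * (1 - ε) = η) (hB : 0 < B)
    (hgB : fourierL1 g ≤ B) (hL : 1 ≤ Real.log n) :
    ∃ R : Ω → ℝ, Integrable R P ∧
      (∀ ω, (thresholded (fun i => X i ω) δ g - coef f g) ^ 2 ≤ R ω) ∧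
      ∫ ω, R ω ∂P ≤ (((1 - θ) ^ 2)⁻¹ + 1 + 48 * δ + 68 * δ ^ 2 + 96 / (θ ^ 2 * ε ^ 2)) *
        (min (coef f g ^ 2) (Real.log n * coefVar P f X g) + Real.log n / n * coef f g ^ 2 +
          Real.log n ^ 2 * B ^ 2 / (n : ℝ) ^ 2 +
          (∫ x, g x ^ 2 ∂(law f)) / n * (n : ℝ) ^ (-η)) := by
  have hn' : (0 : ℝ) < n := by exact_mod_cast hn
  have hη0 : 0 < η := by rw [← hη]; have := sub_pos.2 hε1; positivity
  obtain ⟨R, hRi, hR, hRint⟩ := hs.exists_dominating_bad hg hf hn hδ.le hθ.le hθ1.le hε hε1 hB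
    hgB rfl
  set b := coef f g with hb
  set v := ∫ x, g x ^ 2 ∂(law f) with hv
  have hv0 : 0 ≤ v := integral_nonneg fun _ => sq_nonneg _
  set L := Real.log n with hLdef
  have hL0 : 0 < L := by linarith
  set σ2 := coefVar P f X g with hσ
  have hσ0 : 0 ≤ σ2 := integral_nonneg fun _ => sq_nonneg _
  have hvar : v / n = σ2 + b ^ 2 / n := by
    have := hs.coefVar_eq hg hf hn
    linarith
  obtain ⟨hVi, hVint⟩ := hs.integral_empVar hg hn
  rw [← hv] at hVint
  have hB0 := hg.fourierL1_nonneg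
  have he2i := hs.integrable_sq_error hg hn b
  let R1 : Ω → ℝ := fun ω => min (b ^ 2) ((empCoef (fun i => X i ω) g - b) ^ 2)
  let T : Ω → ℝ := fun ω => 24 * δ * L * empVar (fun i => X i ω) g +
    68 * δ ^ 2 * (L ^ 2 * B ^ 2 / (n : ℝ) ^ 2)
  let R2 : Ω → ℝ := fun ω => min (b ^ 2) (T ω)
  have hTi : Integrable T P := (hVi.const_mul _).add (integrable_const _)
  have hR1i : Integrable R1 P := (integrable_const (b ^ 2)).inf he2i
  have hR2i : Integrable R2 P := (integrable_const (b ^ 2)).inf hTi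
  refine ⟨fun ω => ((1 - θ) ^ 2)⁻¹ * R1 ω + R2 ω + 4 / θ ^ 2 * R ω,
    ((hR1i.const_mul _).add hR2i).add (hRi.const_mul _), fun ω => ?_, ?_⟩
  · refine (thresholded_sq_le (fun i => X i ω) hθ hθ1 (hg.threshold_nonneg _ hδ.le)).trans ?_
    refine add_le_add (add_le_add le_rfl (min_le_min le_rfl ?_))
      (mul_le_mul_of_nonneg_left (hR ω) (by positivity))
    have h1 := hg.threshold_sq_le hn (fun i => X i ω) hδ.le
    have h2 : 17 * δ ^ 2 * (L ^ 2 * fourierL1 g ^ 2 / (n : ℝ) ^ 2) ≤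
        17 * δ ^ 2 * (L ^ 2 * B ^ 2 / (n : ℝ) ^ 2) := by gcongr
    simp only [T]
    linarith
  · set m := min (b ^ 2) (L * σ2) with hm
    have hm0 : 0 ≤ m := le_min (sq_nonneg _) (by positivity)
    set y := L / n * b ^ 2 with hy
    have hy0 : 0 ≤ y := by positivity
    set z := L ^ 2 * B ^ 2 / (n : ℝ) ^ 2 with hz
    have hz0 : 0 ≤ z := by positivity
    have hp0 : 0 < (n : ℝ) ^ (-η) := by positivity
    set w := v / n * (n : ℝ) ^ (-η) with hw
    have hw0 : 0 ≤ w := by positivity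
    have hI1 : ∫ ω, R1 ω ∂P ≤ m := by
      refine le_min ?_ ?_
      · refine (integral_mono hR1i (integrable_const (b ^ 2)) fun ω => min_le_left _ _).trans ?_
        simp
      · refine (integral_mono hR1i he2i fun ω => min_le_right _ _).trans ?_
        exact le_mul_of_one_le_left hσ0 hL
    have hTint : ∫ ω, T ω ∂P = 24 * δ * L * (v / n) + 68 * δ ^ 2 * z := by
      simp only [T]
      rw [integral_add (hVi.const_mul _) (integrable_const _), integral_const_mul, hVint]
      simp [hz]
    have hI2 : ∫ ω, R2 ω ∂P ≤ (1 + 24 * δ) * m + 24 * δ * y + 68 * δ ^ 2 * z := by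
      have h1 : ∫ ω, R2 ω ∂P ≤ b ^ 2 := by
        refine (integral_mono hR2i (integrable_const (b ^ 2)) fun ω => min_le_left _ _).trans ?_
        simp
      have h2 : ∫ ω, R2 ω ∂P ≤ 24 * δ * (L * σ2) + 24 * δ * y + 68 * δ ^ 2 * z := by
        refine (integral_mono hR2i hTi fun ω => min_le_right _ _).trans (le_of_eq ?_)
        rw [hTint, hvar, hy]; ring
      have hy' : 0 ≤ 24 * δ * y := by positivity
      have hz' : 0 ≤ 68 * δ ^ 2 * z := by positivity
      have hm' : 0 ≤ 24 * δ * m := by positivity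
      rcases min_cases (b ^ 2) (L * σ2) with ⟨h, _⟩ | ⟨h, _⟩ <;> rw [← hm] at h
      · linarith
      · rw [← h] at h2; linarith
    have hMη : Real.exp (θ ^ 2 * (δ * L)) ^ (ε - 1) = (n : ℝ) ^ (-η) := by
      rw [← Real.exp_mul, Real.rpow_def_of_pos hn', ← hη]; congr 1; ring
    have hpow1 : (n : ℝ) ^ (-η) ≤ 1 :=
      Real.rpow_le_one_of_one_le_of_nonpos (by exact_mod_cast hn) (by linarith)
    have hI3 : 4 / θ ^ 2 * ∫ ω, R ω ∂P ≤ 96 / (θ ^ 2 * ε ^ 2) * (w + z) := by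
      rw [hMη] at hRint
      have h1 : (v / n + B ^ 2 / (n : ℝ) ^ 2) * (n : ℝ) ^ (-η) ≤ w + z := by
        rw [add_mul]
        refine add_le_add le_rfl ?_
        have h2 : B ^ 2 / (n : ℝ) ^ 2 ≤ z := by
          rw [hz, mul_div_assoc]
          exact le_mul_of_one_le_left (by positivity) (one_le_pow₀ hL)
        exact (mul_le_of_le_one_right (by positivity) hpow1).trans h2
      calc 4 / θ ^ 2 * ∫ ω, R ω ∂P ≤ 4 / θ ^ 2 * (24 / ε ^ 2 * (w + z)) := by
            refine mul_le_mul_of_nonneg_left (hRint.trans ?_) (by positivity)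
            exact mul_le_mul_of_nonneg_left h1 (by positivity)
        _ = _ := by field_simp; ring
    have hR12 : Integrable (fun ω => ((1 - θ) ^ 2)⁻¹ * R1 ω + R2 ω) P :=
      (hR1i.const_mul _).add hR2i
    rw [integral_add hR12 (hRi.const_mul _), integral_add (hR1i.const_mul _) hR2i,
      integral_const_mul, integral_const_mul]
    have hc1 : 0 ≤ ((1 - θ) ^ 2)⁻¹ := by positivity
    have hc3 : 0 ≤ 96 / (θ ^ 2 * ε ^ 2) := by positivity
    have hI1' := mul_le_mul_of_nonneg_left hI1 hc1
    generalize ((1 - θ) ^ 2)⁻¹ = c1 at *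
    generalize 96 / (θ ^ 2 * ε ^ 2) = c3 at *
    have e : (c1 + 1 + 48 * δ + 68 * δ ^ 2 + c3) * (m + y + z + w) -
        (c1 * m + ((1 + 24 * δ) * m + 24 * δ * y + 68 * δ ^ 2 * z) + c3 * (w + z)) =
        c1 * (y + z + w) + (y + z + w) + 24 * δ * (m + y) + 48 * δ * (z + w) +
          68 * δ ^ 2 * (m + y + w) + c3 * (m + y) := by ring
    have : 0 ≤ c1 * (y + z + w) + (y + z + w) + 24 * δ * (m + y) + 48 * δ * (z + w) +
          68 * δ ^ 2 * (m + y + w) + c3 * (m + y) := by positivity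
    linarith

end Sample

/-! ### Summation over the scales -/

lemma sum_Icc_pow_le {r : ℝ} (hr : 2 ≤ r) (j₀ j₁ : ℕ) :
    ∑ j ∈ Finset.Icc j₀ j₁, r ^ j ≤ 2 * r ^ j₁ := by
  have h1 : ∑ j ∈ Finset.Icc j₀ j₁, r ^ j ≤ ∑ j ∈ Finset.range (j₁ + 1), r ^ j :=
    Finset.sum_le_sum_of_subset_of_nonneg
      (fun j hj => Finset.mem_range.2 (Nat.lt_succ_of_le (Finset.mem_Icc.1 hj).2))
      fun j _ _ => by positivity
  refine h1.trans ?_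
  clear h1
  induction j₁ with
  | zero => norm_num
  | succ j ih =>
    rw [Finset.sum_range_succ]
    have : 0 ≤ r ^ j := by positivity
    rw [pow_succ]
    nlinarith

/-- The fraction `θ` of the threshold which an error may reach harmlessly; with
`ε = 1 - θ²` it satisfies `θ² δ (1 - ε) = η`. -/
noncomputable def errorFraction (η δ : ℝ) : ℝ := Real.sqrt (Real.sqrt (η / δ))

lemma errorFraction_pow_four {η δ : ℝ} (hη : 0 < η) (hδ : η < δ) :
    errorFraction η δ ^ 4 = η / δ := by
  have : 0 ≤ η / δ := (div_pos hη (hη.trans hδ)).le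
  rw [show errorFraction η δ ^ 4 = (errorFraction η δ ^ 2) ^ 2 by ring, errorFraction,
    Real.sq_sqrt (Real.sqrt_nonneg _), Real.sq_sqrt this]

lemma errorFraction_pos {η δ : ℝ} (hη : 0 < η) (hδ : η < δ) : 0 < errorFraction η δ :=
  Real.sqrt_pos.2 (Real.sqrt_pos.2 (div_pos hη (hη.trans hδ)))

lemma errorFraction_lt_one {η δ : ℝ} (hη : 0 < η) (hδ : η < δ) : errorFraction η δ < 1 := by
  by_contra! h
  have h1 := one_le_pow₀ h (n := 4)
  rw [errorFraction_pow_four hη hδ, le_div_iff₀ (hη.trans hδ)] at h1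
  linarith

/-- Constant in the oracle inequality for one coefficient. -/
noncomputable def oracleConst (η δ : ℝ) : ℝ :=
  ((1 - errorFraction η δ) ^ 2)⁻¹ + 1 + 48 * δ + 68 * δ ^ 2 +
    96 / (errorFraction η δ ^ 2 * (1 - errorFraction η δ ^ 2) ^ 2)

lemma le_oracleConst {η δ : ℝ} (hδ : 0 < δ) :
    ((1 - errorFraction η δ) ^ 2)⁻¹ + 1 ≤ oracleConst η δ := by
  have : 0 ≤ 48 * δ + 68 * δ ^ 2 +
    96 / (errorFraction η δ ^ 2 * (1 - errorFraction η δ ^ 2) ^ 2) := by positivity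
  rw [oracleConst]; linarith

lemma tendsto_oracleConst {η : ℝ} (hη : 0 < η) : Tendsto (oracleConst η) (𝓝[>] η) atTop := by
  have h1 : Tendsto (fun δ => (1 - errorFraction η δ) ^ 2) (𝓝[>] η) (𝓝[>] 0) := by
    refine tendsto_nhdsWithin_iff.2 ⟨?_, ?_⟩
    · have hc : ContinuousAt (fun δ => (1 - errorFraction η δ) ^ 2) η := by
        have : ContinuousAt (fun δ => η / δ) η := continuousAt_const.div continuousAt_id hη.ne'
        exact (continuousAt_const.sub (this.sqrt.sqrt)).pow 2
      have h0 : (1 - errorFraction η η) ^ 2 = 0 := by simp [errorFraction, div_self hη.ne']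
      have := hc.tendsto
      rw [h0] at this
      exact this.mono_left nhdsWithin_le_nhds
    · filter_upwards [self_mem_nhdsWithin] with δ hδ
      exact pow_pos (sub_pos.2 (errorFraction_lt_one hη hδ)) 2
  refine tendsto_atTop_mono' _ ?_ (tendsto_inv_nhdsGT_zero.comp h1)
  filter_upwards [self_mem_nhdsWithin] with δ hδ
  have := le_oracleConst (η := η) (hη.trans hδ)
  simp only [Function.comp_apply]
  linarith

section Sample

variable {Ω : Type*} [MeasurableSpace Ω] {P : Measure Ω} [IsProbabilityMeasure P] {n : ℕ}
  {X : Fin n → Ω → ℝ} {f : ℝ → ℝ}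

/-- The risk is bounded by the variances of the scaling coefficients, the oracle bounds for the
thresholded wavelet coefficients, and the energy at the discarded scales. -/
lemma IsIIDSample.risk_le (hs : IsIIDSample P f X) (hf : IsL2Density f) (h : MeyerFilter)
    {η δ : ℝ} (hη : 0 < η) (hδ : η < δ) (hn : 0 < n) (hL : 1 ≤ Real.log n) {j₀ j₁ : ℕ}
    (hj : j₀ ≤ j₁) :
    risk P f X h δ j₀ j₁ ≤ ENNReal.ofReal (
      2 * (∑ k ∈ Finset.range (2 ^ j₀), coefVar P f X (h.phi j₀ k) +
        ∑ j ∈ Finset.Icc j₀ j₁, ∑ k ∈ Finset.range (2 ^ j), oracleConst η δ *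
          (min (coef f (h.psi j k) ^ 2) (Real.log n * coefVar P f X (h.psi j k)) +
            Real.log n / n * coef f (h.psi j k) ^ 2 +
            Real.log n ^ 2 * (25 * 2 ^ j) / (n : ℝ) ^ 2 +
            (∫ x, h.psi j k x ^ 2 ∂(law f)) / n * (n : ℝ) ^ (-η))) +
      2 * ∑' i : ℕ, h.waveletEnergy f (j₁ + 1 + i)) := by
  have hδ0 : 0 < δ := hη.trans hδ
  set θ := errorFraction η δ with hθdef
  have hθ := errorFraction_pos hη hδ
  have hθ1 := errorFraction_lt_one hη hδ
  have hθ2 : θ ^ 2 < 1 := pow_lt_one₀ hθ.le hθ1 two_ne_zero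
  have hpar : θ ^ 2 * δ * (1 - (1 - θ ^ 2)) = η := by
    have := errorFraction_pow_four hη hδ
    rw [← hθdef] at this
    rw [show θ ^ 2 * δ * (1 - (1 - θ ^ 2)) = θ ^ 4 * δ by ring, this]
    field_simp
  have hBsq : ∀ j : ℕ, Real.sqrt (25 * 2 ^ j) ^ 2 = 25 * 2 ^ j := fun j =>
    Real.sq_sqrt (by positivity)
  have hB : ∀ j k : ℕ, fourierL1 (h.psi j k) ≤ Real.sqrt (25 * 2 ^ j) := fun j k =>
    Real.le_sqrt_of_sq_le (h.isBandLimited_psiHat.fourierL1_sq_le j k)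
  choose R hRi hR hRint using fun j k => hs.exists_dominating_thresholded (h.isTrigPoly_psi j k)
    hf hn hδ0 hθ hθ1 (by linarith : 0 < 1 - θ ^ 2) (by linarith [sq_pos_of_pos hθ])
    hpar (Real.sqrt_pos.2 (by positivity : (0 : ℝ) < 25 * 2 ^ j)) (hB j k) hL
  let D : Ω → ℝ := fun ω =>
    2 * (∑ k ∈ Finset.range (2 ^ j₀),
        (empCoef (fun i => X i ω) (h.phi j₀ k) - coef f (h.phi j₀ k)) ^ 2 +
      ∑ j ∈ Finset.Icc j₀ j₁, ∑ k ∈ Finset.range (2 ^ j), R j k ω) +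
    2 * ∑' i : ℕ, h.waveletEnergy f (j₁ + 1 + i)
  have hi1 : ∀ k, Integrable (fun ω =>
      (empCoef (fun i => X i ω) (h.phi j₀ k) - coef f (h.phi j₀ k)) ^ 2) P := fun k =>
    hs.integrable_sq_error (h.isTrigPoly_phi j₀ k) hn _
  have hi1s := integrable_finsetSum (Finset.range (2 ^ j₀)) fun k _ => hi1 k
  have hi2 : ∀ j, Integrable (fun ω => ∑ k ∈ Finset.range (2 ^ j), R j k ω) P := fun j =>
    integrable_finsetSum _ fun k _ => hRi j k
  have hi2s := integrable_finsetSum (Finset.Icc j₀ j₁) fun j _ => hi2 j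
  have htail : 0 ≤ ∑' i : ℕ, h.waveletEnergy f (j₁ + 1 + i) :=
    tsum_nonneg fun i => h.waveletEnergy_nonneg f _
  have hi12 : Integrable (fun ω => ∑ k ∈ Finset.range (2 ^ j₀),
      (empCoef (fun i => X i ω) (h.phi j₀ k) - coef f (h.phi j₀ k)) ^ 2 +
      ∑ j ∈ Finset.Icc j₀ j₁, ∑ k ∈ Finset.range (2 ^ j), R j k ω) P := hi1s.add hi2s
  have hDi : Integrable D P := (hi12.const_mul 2).add (integrable_const _)
  have hR0 : ∀ j k ω, 0 ≤ R j k ω := fun j k ω => (sq_nonneg _).trans (hR j k ω)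
  have hD0 : ∀ ω, 0 ≤ D ω := fun ω => by
    refine add_nonneg (mul_nonneg zero_le_two (add_nonneg ?_ ?_)) (by positivity)
    · exact Finset.sum_nonneg fun _ _ => sq_nonneg _
    · exact Finset.sum_nonneg fun j _ => Finset.sum_nonneg fun k _ => hR0 j k ω
  calc risk P f X h δ j₀ j₁ ≤ ∫⁻ ω, ENNReal.ofReal (D ω) ∂P := by
        refine lintegral_mono fun ω => (h.eLpNorm_estimator_sub_le hf.memLp _ δ hj).trans ?_
        refine ENNReal.ofReal_le_ofReal ?_
        simp only [D]
        gcongr with j _ k _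
        exact hR j k ω
    _ = ENNReal.ofReal (∫ ω, D ω ∂P) :=
        (ofReal_integral_eq_lintegral_ofReal hDi (Eventually.of_forall hD0)).symm
    _ ≤ _ := by
        refine ENNReal.ofReal_le_ofReal ?_
        simp only [D]
        rw [integral_add (hi12.const_mul 2) (integrable_const _), integral_const_mul,
          integral_add hi1s hi2s, integral_finsetSum _ fun k _ => hi1 k,
          integral_finsetSum _ fun j _ => hi2 j]
        simp_rw [integral_finsetSum _ fun k _ => hRi _ k]
        rw [integral_const, probReal_univ, one_smul]
        refine add_le_add (mul_le_mul_of_nonneg_left (add_le_add le_rfl ?_) zero_le_two) le_rfl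
        refine Finset.sum_le_sum fun j _ => Finset.sum_le_sum fun k _ => ?_
        have := hRint j k
        rwa [hBsq] at this

end Sample

/-- The noise terms of all coefficients up to scale `j₁` fit into the remainder. -/
lemma sum_noise_le (h : MeyerFilter) {f : ℝ → ℝ} (hf : IsL2Density f) (hb : BoundedOnUnit f)
    {α η : ℝ} {n : ℕ} (hn : 0 < n) (hL : 1 ≤ Real.log n) {j₀ j₁ : ℕ}
    (hj₁ : IsDyadicLevel ((n : ℝ) ^ η * Real.log n ^ α) j₁) :
    ∑ j ∈ Finset.Icc j₀ j₁, ∑ k ∈ Finset.range (2 ^ j),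
      (Real.log n ^ 2 * (25 * 2 ^ j) / (n : ℝ) ^ 2 +
        (∫ x, h.psi j k x ^ 2 ∂(law f)) / n * (n : ℝ) ^ (-η)) ≤
    200 * (max (supNorm f) 1 * max (Real.log n ^ α) 1 * (Real.log n ^ α / n) +
      Real.log n ^ (2 + 2 * α) / (n : ℝ) ^ (2 * (1 - η))) := by
  have hn' : (0 : ℝ) < n := by exact_mod_cast hn
  set L := Real.log n with hLdef
  have hL0 : 0 < L := by linarith
  have hpow : (2 : ℝ) ^ j₁ ≤ 2 * ((n : ℝ) ^ η * L ^ α) := by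
    have := hj₁.2
    rw [zpow_sub_one₀ (by norm_num), zpow_natCast] at this
    linarith
  have hpow4 : (4 : ℝ) ^ j₁ ≤ 4 * ((n : ℝ) ^ (2 * η) * L ^ (2 * α)) := by
    have h1 := pow_le_pow_left₀ (by positivity) hpow 2
    rw [← pow_mul, mul_comm j₁ 2, pow_mul] at h1
    have h2 : (2 * ((n : ℝ) ^ η * L ^ α)) ^ 2 = 4 * ((n : ℝ) ^ (2 * η) * L ^ (2 * α)) := by
      rw [mul_pow, mul_pow, ← Real.rpow_mul_natCast hn'.le, ← Real.rpow_mul_natCast hL0.le,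
        mul_comm η, mul_comm α]
      norm_num
    rw [h2] at h1
    norm_num at h1
    exact h1
  have hF : 0 ≤ max (supNorm f) 1 := le_max_of_le_right zero_le_one
  set F := max (supNorm f) 1 with hFdef
  have hv : ∀ j k, k < 2 ^ j → ∫ x, h.psi j k x ^ 2 ∂(law f) ≤ F := fun j k hk => by
    refine (integral_law_sq_le hf hb (h.isTrigPoly_psi j k).continuous).trans ?_
    have h0 : 0 ≤ ∫ x in (0 : ℝ)..1, h.psi j k x ^ 2 :=
      intervalIntegral.integral_nonneg zero_le_one fun _ _ => sq_nonneg _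
    calc _ ≤ F * ∫ x in (0 : ℝ)..1, h.psi j k x ^ 2 :=
          mul_le_mul_of_nonneg_right (le_max_left _ _) h0
      _ ≤ F := mul_le_of_le_one_right hF (h.integral_psi_sq_le hk)
  calc _ ≤ ∑ j ∈ Finset.Icc j₀ j₁, ∑ k ∈ Finset.range (2 ^ j),
        (L ^ 2 * (25 * 2 ^ j) / (n : ℝ) ^ 2 + F / n * (n : ℝ) ^ (-η)) := by
        refine Finset.sum_le_sum fun j _ => Finset.sum_le_sum fun k hk => ?_
        gcongr
        exact hv j k (Finset.mem_range.1 hk)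
    _ = 25 * L ^ 2 / (n : ℝ) ^ 2 * (∑ j ∈ Finset.Icc j₀ j₁, (4 : ℝ) ^ j) +
        F / n * (n : ℝ) ^ (-η) * ∑ j ∈ Finset.Icc j₀ j₁, (2 : ℝ) ^ j := by
        rw [Finset.mul_sum, Finset.mul_sum, ← Finset.sum_add_distrib]
        refine Finset.sum_congr rfl fun j _ => ?_
        rw [Finset.sum_const, Finset.card_range, nsmul_eq_mul, show (4 : ℝ) = 2 * 2 by norm_num,
          mul_pow]
        push_cast
        ring
    _ ≤ 25 * L ^ 2 / (n : ℝ) ^ 2 * (2 * (4 * ((n : ℝ) ^ (2 * η) * L ^ (2 * α)))) +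
        F / n * (n : ℝ) ^ (-η) * (2 * (2 * ((n : ℝ) ^ η * L ^ α))) := by
        gcongr
        · exact (sum_Icc_pow_le (by norm_num) _ _).trans (by gcongr)
        · exact (sum_Icc_pow_le le_rfl _ _).trans (by gcongr)
    _ = 200 * (L ^ (2 + 2 * α) / (n : ℝ) ^ (2 * (1 - η))) + 4 * (F * 1 * (L ^ α / n)) := by
        have e1 : L ^ (2 + 2 * α) = L ^ 2 * L ^ (2 * α) := by
          rw [Real.rpow_add hL0]; norm_cast
        have e2 : (n : ℝ) ^ (2 * (1 - η)) = (n : ℝ) ^ 2 * ((n : ℝ) ^ (2 * η))⁻¹ := by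
          rw [← Real.rpow_neg hn'.le, ← Real.rpow_natCast, ← Real.rpow_add hn']
          congr 1; push_cast; ring
        have e3 : (n : ℝ) ^ (-η) = ((n : ℝ) ^ η)⁻¹ := Real.rpow_neg hn'.le η
        rw [e1, e2, e3]
        have : (n : ℝ) ^ η ≠ 0 := by positivity
        have : (n : ℝ) ^ (2 * η) ≠ 0 := by positivity
        field_simp
        ring
    _ ≤ 200 * (L ^ (2 + 2 * α) / (n : ℝ) ^ (2 * (1 - η))) +
        200 * (F * max (L ^ α) 1 * (L ^ α / n)) := by
        gcongr
        · norm_num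
        · exact le_max_right _ _
    _ = _ := by ring

end MeyerDensity

open MeyerDensity in
theorem mainTheorem2 (h : MeyerDensity.MeyerFilter) (α η : ℝ) (hα : 0 ≤ α)
    (hη : 0 < η) (hη' : η ≤ 1 / 2) :
    ∃ C₁ C₂ : ℝ → ℝ,
      (∀ δ, η < δ → 0 < C₁ δ ∧ 0 < C₂ δ) ∧
      Tendsto C₁ (𝓝[>] η) atTop ∧ Tendsto C₂ (𝓝[>] η) atTop ∧
      ∀ δ : ℝ, η < δ →
      ∀ f : ℝ → ℝ, MeyerDensity.IsL2Density f → MeyerDensity.BoundedOnUnit f →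
      ∀ n : ℕ, Real.exp 1 ≤ n →
      ∀ j₀ j₁ : ℕ, MeyerDensity.IsDyadicLevel (Real.log n) j₀ →
        MeyerDensity.IsDyadicLevel ((n : ℝ) ^ η * Real.log n ^ α) j₁ → j₀ ≤ j₁ →
      ∀ (Ω : Type*) [MeasurableSpace Ω] (P : Measure Ω) [IsProbabilityMeasure P]
        (X : Fin n → Ω → ℝ), MeyerDensity.IsIIDSample P f X →
        MeyerDensity.risk P f X h δ j₀ j₁ ≤
          ENNReal.ofReal (C₁ δ * MeyerDensity.oracleBound P f X h j₀ j₁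
            + C₂ δ * MeyerDensity.remainder h η α f n j₀ j₁) := by
  have hK1 : ∀ δ, η < δ → 1 ≤ oracleConst η δ := fun δ hδ => by
    have h1 := le_oracleConst (η := η) (hη.trans hδ)
    have h2 : 0 ≤ ((1 - errorFraction η δ) ^ 2)⁻¹ := by positivity
    linarith
  refine ⟨fun δ => 2 * oracleConst η δ, fun δ => 400 * oracleConst η δ, fun δ hδ => ?_,
    (tendsto_oracleConst hη).const_mul_atTop (by norm_num),
    (tendsto_oracleConst hη).const_mul_atTop (by norm_num), ?_⟩
  · have := hK1 δ hδ
    constructor <;> linarith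
  intro δ hδ f hf hb n hne j₀ j₁ _ hj₁ hj Ω _ P _ X hs
  have hn' : (0 : ℝ) < n := (Real.exp_pos 1).trans_le hne
  have hn : 0 < n := by exact_mod_cast hn'
  have hL : 1 ≤ Real.log n := (Real.le_log_iff_exp_le hn').2 hne
  refine (hs.risk_le hf h hη hδ hn hL hj).trans (ENNReal.ofReal_le_ofReal ?_)
  have hnoise := sum_noise_le h hf hb hn hL (j₀ := j₀) hj₁
  have hK := hK1 δ hδ
  set K := oracleConst η δ
  set A := ∑ k ∈ Finset.range (2 ^ j₀), coefVar P f X (h.phi j₀ k)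
  set T := ∑' i : ℕ, h.waveletEnergy f (j₁ + 1 + i)
  set E := Real.log n / n *
    ∑ j ∈ Finset.Icc j₀ j₁, ∑ k ∈ Finset.range (2 ^ j), coef f (h.psi j k) ^ 2
  set M := ∑ j ∈ Finset.Icc j₀ j₁, ∑ k ∈ Finset.range (2 ^ j),
    min (coef f (h.psi j k) ^ 2) (Real.log n * coefVar P f X (h.psi j k))
  set N := ∑ j ∈ Finset.Icc j₀ j₁, ∑ k ∈ Finset.range (2 ^ j),
    (Real.log n ^ 2 * (25 * 2 ^ j) / (n : ℝ) ^ 2 +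
      (∫ x, h.psi j k x ^ 2 ∂(law f)) / n * (n : ℝ) ^ (-η))
  have hsplit : ∑ j ∈ Finset.Icc j₀ j₁, ∑ k ∈ Finset.range (2 ^ j), K *
      (min (coef f (h.psi j k) ^ 2) (Real.log n * coefVar P f X (h.psi j k)) +
        Real.log n / n * coef f (h.psi j k) ^ 2 + Real.log n ^ 2 * (25 * 2 ^ j) / (n : ℝ) ^ 2 +
        (∫ x, h.psi j k x ^ 2 ∂(law f)) / n * (n : ℝ) ^ (-η)) = K * (M + (E + N)) := by
    simp only [M, E, N, Finset.mul_sum, ← Finset.sum_add_distrib]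
    exact Finset.sum_congr rfl fun j _ => Finset.sum_congr rfl fun k _ => by ring
  have hA : 0 ≤ A := Finset.sum_nonneg fun k _ => integral_nonneg fun _ => sq_nonneg _
  have hT : 0 ≤ T := tsum_nonneg fun i => h.waveletEnergy_nonneg f _
  have hE : 0 ≤ E := mul_nonneg (by positivity)
    (Finset.sum_nonneg fun j _ => Finset.sum_nonneg fun k _ => sq_nonneg _)
  rw [hsplit]
  change _ ≤ 2 * K * (A + M + T) + 400 * K * (E + _ + _)
  rw [add_assoc E]
  nlinarith [mul_le_mul_of_nonneg_left hnoise (by linarith : 0 ≤ K),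
    mul_le_mul_of_nonneg_right hK hA, mul_le_mul_of_nonneg_right hK hT,
    mul_nonneg (by linarith : 0 ≤ K) hE]
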